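/- Let $d,m\ge 2$, let $A,V:\mathbb R^d\to\mathbb R^m$ be linear maps (Euclidean norms and inner products), and let $\sigma_1=\|A-V\|$ be the operator norm, i.e. the largest singular value of $A-V$. Consider the following algorithm with one common optimal step size. It starts from unit vectors $u^0\in\mathbb R^m$, $v^0\in\mathbb R^d$ with $\langle u^0,(A-V)v^0\rangle\ge 0$. For $k=0,1,2,\dots$ it samples $y^k\sim\mathcal N(0,I_d)$ and $z^k\sim\mathcal N(0,I_m)$ (all samples independent of each other and of $(u^0,v^0)$), and sets $$x^k=\frac{y^k-\langle y^k,v^k\rangle v^k}{\|y^k-\langle y^k,v^k\rangle v^k\|},\qquad w^k=\frac{z^k-\langle z^k,u^k\rangle u^k}{\|z^k-\langle z^k,u^k\rangle u^k\|},$$ $$\tau_k=\operatorname*{argmax}_{\tau\in\mathbb R}\frac{\langle u^k+\tau w^k,(A-V)(v^k+\tau x^k)\rangle}{\|u^k+\tau w^k\|\,\|v^k+\tau x^k\|},\qquad v^{k+1}=\frac{v^k+\tau_kx^k}{\sqrt{1+\tau_k^2}},\quad u^{k+1}=\frac{u^k+\tau_kw^k}{\sqrt{1+\tau_k^2}},$$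 with $\tau_k=0$ if the function to be maximized is constant in $\tau$. Assume that one of the following holds for the initialization: (a) $u$ and $v^0$ are independent and uniformly distributed on the unit spheres $\mathbb S^{m-1}$ and $\mathbb S^{d-1}$, and $u^0=u$ if $\langle u,(A-V)v^0\rangle>0$, $u^0=-u$ otherwise; or (b) $\max\{m,d\}\ge 3$, and $(u^0,v^0)$ is any deterministic or random pair of unit vectors with $\langle u^0,(A-V)v^0\rangle\ge0$ which almost surely is not a pair of left and right singular vectors of $A-V$ to a common singular value (that is, there is almost surely no $\sigma\ge 0$ with $(A-V)v^0=\sigma u^0$ and $(A-V)^*u^0=\sigma v^0$). Then almost surely a maximizer $\tau_k$ exists in every iteration, and $$\lim_{k\to\infty}\langle u^k,(A-V)v^k\rangle=\sigma_1\quad\text{almost surely.}$$ Moreover, if the singular space $\{v\in\mathbb R^d: (A-V)^*(A-V)v=\sigma_1^2v\}$ is one-dimensional, then almost surely $(u^k,v^k)$ converges to a pair $(\bar u,\bar v)$ of unit vectors with $(A-V)\bar v=\sigma_1\bar u$ and $(A-V)^*\bar u=\sigma_1\bar v$. -/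

import Mathlib

namespace JointStep

open MeasureTheory ProbabilityTheory

/-- `ℝⁿ` with the Euclidean norm and inner product. -/
abbrev E (n : ℕ) : Type := EuclideanSpace ℝ (Fin n)

section Algorithm

variable {d m : ℕ}

/-- The objective value `⟨u, A v⟩ - ⟨V* u, v⟩`, which is `⟨u, (A - V) v⟩`. -/
noncomputable def objective (A V : E d →L[ℝ] E m) (u : E m) (v : E d) : ℝ :=
  inner ℝ u (A v) - inner ℝ (ContinuousLinearMap.adjoint V u) v

theorem objective_eq (A V : E d →L[ℝ] E m) (u : E m) (v : E d) :
    objective A V u v = inner ℝ u ((A - V) v) := by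
  simp [objective, ContinuousLinearMap.adjoint_inner_left, inner_sub_right]

/-- The normalized projection `(g - ⟨g, c⟩ c) / ‖g - ⟨g, c⟩ c‖` of the sample `g` onto the
hyperplane orthogonal to the unit vector `c`. -/
noncomputable def direction {n : ℕ} (c g : E n) : E n :=
  ‖g - (inner ℝ g c : ℝ) • c‖⁻¹ • (g - (inner ℝ g c : ℝ) • c)

/-- The normalized objective `τ ↦ ⟨u + τ w, (A - V)(v + τ x)⟩ / (‖u + τ w‖ ‖v + τ x‖)`. -/
noncomputable def lineObjective (A V : E d →L[ℝ] E m) (u : E m) (v : E d) (w : E m) (x : E d)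
    (τ : ℝ) : ℝ :=
  inner ℝ (u + τ • w) ((A - V) (v + τ • x)) / (‖u + τ • w‖ * ‖v + τ • x‖)

/-- `τ` is a maximizer over `ℝ` of the objective along the line. -/
def IsOptimalStep (A V : E d →L[ℝ] E m) (u : E m) (v : E d) (w : E m) (x : E d) (τ : ℝ) : Prop :=
  ∀ t : ℝ, lineObjective A V u v w x t ≤ lineObjective A V u v w x τ

open Classical in
/-- The common step size: the unique maximizer of the objective along the line. If the objective is
constant along the line (every step is then optimal) the step `0` is taken. If there is no
maximizer the algorithm is undefined and `0` is a placeholder. -/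
noncomputable def stepSize (A V : E d →L[ℝ] E m) (u : E m) (v : E d) (w : E m) (x : E d) : ℝ :=
  if h : ∃! τ : ℝ, IsOptimalStep A V u v w x τ then h.choose else 0

/-- One iteration: from `p = (u, v)` and the samples `g = (z, y)` to the next pair. -/
noncomputable def step (A V : E d →L[ℝ] E m) (p g : E m × E d) : E m × E d :=
  let w := direction p.1 g.1
  let x := direction p.2 g.2
  let τ := stepSize A V p.1 p.2 w x
  ((√(1 + τ ^ 2))⁻¹ • (p.1 + τ • w), (√(1 + τ ^ 2))⁻¹ • (p.2 + τ • x))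

/-- The iterates `(u^k, v^k)` started in `p` and driven by the samples `g k = (z^k, y^k)`. -/
noncomputable def iterate (A V : E d →L[ℝ] E m) (p : E m × E d) (g : ℕ → E m × E d) :
    ℕ → E m × E d
  | 0 => p
  | k + 1 => step A V (iterate A V p g k) (g k)

/-- The step size `τ_k` used in iteration `k` maximizes the objective of that iteration. -/
def IsOptimalAt (A V : E d →L[ℝ] E m) (p : E m × E d) (g : ℕ → E m × E d) (k : ℕ) : Prop :=
  let q := iterate A V p g k
  let w := direction q.1 (g k).1
  let x := direction q.2 (g k).2
  IsOptimalStep A V q.1 q.2 w x (stepSize A V q.1 q.2 w x)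

/-- `(u, v)` is a pair of normalized left and right singular vectors of `B` to the common
singular value `σ`. -/
def IsSingularPair (B : E d →L[ℝ] E m) (σ : ℝ) (u : E m) (v : E d) : Prop :=
  0 ≤ σ ∧ ‖u‖ = 1 ∧ ‖v‖ = 1 ∧ B v = σ • u ∧ ContinuousLinearMap.adjoint B u = σ • v

/-- The singular space `{v | B* B v = ‖B‖² v}` to the largest singular value `σ₁ = ‖B‖`. -/
noncomputable def topSingularSpace (B : E d →L[ℝ] E m) : Submodule ℝ (E d) :=
  Module.End.eigenspace ((ContinuousLinearMap.adjoint B ∘L B : E d →L[ℝ] E d) : E d →ₗ[ℝ] E d)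
    (‖B‖ ^ 2)

end Algorithm

section Randomness

variable {d m : ℕ} {Ω : Type*} [MeasurableSpace Ω]

/-- The uniform probability distribution on the unit sphere, as a measure on `ℝⁿ`
(for `n ≥ 1`). -/
noncomputable def uniformSphere (n : ℕ) : Measure (E n) :=
  Measure.map Subtype.val (cond (volume : Measure (E n)).toSphere Set.univ)

/-- The samples `z^k ∼ N(0, I_m)`, `y^k ∼ N(0, I_d)` are all independent of each other. -/
structure IsGaussianSampling (P : Measure Ω) (z : ℕ → Ω → E m) (y : ℕ → Ω → E d) : Prop where
  law_z : ∀ k, HasLaw (z k) (stdGaussian (E m)) P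
  law_y : ∀ k, HasLaw (y k) (stdGaussian (E d)) P
  indep_pair : ∀ k, IndepFun (z k) (y k) P
  indep_steps : iIndepFun (fun k ω => (z k ω, y k ω)) P

/-- Uniform random initialization: independent uniform points on the two unit spheres, where the
sign of the first one is flipped if the objective value is not positive. -/
def IsUniformStart (A V : E d →L[ℝ] E m) (P : Measure Ω) (u₀ : Ω → E m) (v₀ : Ω → E d) : Prop :=
  ∃ u : Ω → E m, HasLaw u (uniformSphere m) P ∧ HasLaw v₀ (uniformSphere d) P ∧
    IndepFun u v₀ P ∧
    ∀ ω, (0 < objective A V (u ω) (v₀ ω) → u₀ ω = u ω) ∧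
      (objective A V (u ω) (v₀ ω) ≤ 0 → u₀ ω = -u ω)

/-- Any other (deterministic or random) initialization by unit vectors with nonnegative objective
that are almost surely not a pair of singular vectors to a common singular value. -/
structure IsNonsingularStart (A V : E d →L[ℝ] E m) (P : Measure Ω) (u₀ : Ω → E m)
    (v₀ : Ω → E d) : Prop where
  aemeasurable_u : AEMeasurable u₀ P
  aemeasurable_v : AEMeasurable v₀ P
  norm_u : ∀ᵐ ω ∂P, ‖u₀ ω‖ = 1
  norm_v : ∀ᵐ ω ∂P, ‖v₀ ω‖ = 1
  objective_nonneg : ∀ᵐ ω ∂P, 0 ≤ objective A V (u₀ ω) (v₀ ω)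
  not_singular : ∀ᵐ ω ∂P, ¬ ∃ σ : ℝ, IsSingularPair (A - V) σ (u₀ ω) (v₀ ω)

end Randomness

end JointStep

namespace JointStep
open MeasureTheory ProbabilityTheory Filter Topology

/-! ### Chains driven by independent samples. -/

section Markov

variable {Ω S G T : Type*} [MeasurableSpace Ω] [MeasurableSpace S] [MeasurableSpace G]
  [MeasurableSpace T] {P : Measure Ω} [IsProbabilityMeasure P]

/-! Put B = A - V. Along unit directions w ⊥ u, x ⊥ v the objective is (a + τb + τ²c)/(1 + τ²) with
a = ⟨u, Bv⟩, b = ⟨w, Bv⟩ + ⟨u, Bx⟩, c = ⟨w, Bx⟩, the Rayleigh quotient of a symmetric 2×2 matrix.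
Its supremum is the top eigenvalue. This exceeds a exactly if b ≠ 0 or c > a, and it is attained
unless b = 0 and c > a.

Convergence: the objective increases and stays below ‖B‖, so the gains have a bounded sum. Each
sample is independent of the current state, hence Φ(state), the expected gain over a fresh sample,
is almost surely summable along the chain and tends to 0 (`chain_tendsto_lintegral`). A unit pair
with value in [0, ‖B‖) always has directions of positive gain, even if it is a singular pair
(`exists_increasing_directions`). By Fatou's lemma and the full support of the Gaussian it is not a
limit point (`pairing_eq_norm_of_tendsto_lintegral_gain`); compactness does the rest.

Existence of maximizers: a set of states is needed that the chain almost surely never leaves and on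
which b = 0, c > a has probability zero. If max(m, d) ≥ 3, this is the set of pairs that are not
singular or already optimal: there b ≠ 0 or the value is ‖B‖, and a step hits a lower singular pair
with probability zero (`ae_explicitStep_mem_nonsingularPairs`). If m = d = 2, directions are quarter
turns and b = 0 can have positive probability; there B splits into a conformal and an anticonformal
part, and each step fixes one part and maximizes the other
(`explicitStep_mem_generalPositionPairs`).

Convergence of the pairs: a one-dimensional top singular space leaves only the sign of v^k open, and
⟨v^k, v^{k+1}⟩ ≥ 0 forbids flips (`exists_tendsto_singularPair`). -/

theorem indepFun_prodMk_of_indepFun {X : Ω → S} {Y : Ω → G} {Z : Ω → T}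
    (hX : AEMeasurable X P) (hY : AEMeasurable Y P) (hZ : AEMeasurable Z P)
    (h : IndepFun X (fun ω => (Y ω, Z ω)) P) (hYZ : IndepFun Y Z P) :
    IndepFun (fun ω => (X ω, Y ω)) Z P := by
  have hXY : IndepFun X Y P := h.comp (φ := id) (ψ := Prod.fst) measurable_id measurable_fst
  have e1 := (indepFun_iff_map_prod_eq_prod_map_map hX (hY.prodMk hZ)).1 h
  have e2 := (indepFun_iff_map_prod_eq_prod_map_map hY hZ).1 hYZ
  have e3 := (indepFun_iff_map_prod_eq_prod_map_map hX hY).1 hXY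
  have := Measure.isProbabilityMeasure_map hX
  have := Measure.isProbabilityMeasure_map hY
  have := Measure.isProbabilityMeasure_map hZ
  rw [indepFun_iff_map_prod_eq_prod_map_map (hX.prodMk hY) hZ, e3]
  have key : P.map (fun ω => ((X ω, Y ω), Z ω))
      = (P.map (fun ω => (X ω, (Y ω, Z ω)))).map MeasurableEquiv.prodAssoc.symm := by
    rw [AEMeasurable.map_map_of_aemeasurable MeasurableEquiv.prodAssoc.symm.measurable.aemeasurable
      (hX.prodMk (hY.prodMk hZ))]
    rfl
  rw [key, e1, e2]
  have := (measurePreserving_prodAssoc (P.map X) (P.map Y) (P.map Z)).symm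
    (MeasurableEquiv.prodAssoc)
  exact this.map_eq

theorem iIndepFun.indepFun_tail {g : ℕ → Ω → G} (hg : ∀ k, AEMeasurable (g k) P)
    (h : iIndepFun g P) (k : ℕ) :
    IndepFun (g k) (fun ω (j : ℕ) => g (k + 1 + j) ω) P := by
  classical
  refine IndepFun.indepFun_process₀ (hg k) (fun j => hg _) fun I => ?_
  have hd : Disjoint ({k} : Finset ℕ) (I.image fun j => k + 1 + j) := by
    simp only [Finset.disjoint_singleton_left, Finset.mem_image, not_exists, not_and]
    intro j _ hj
    omega
  have := iIndepFun.indepFun_finset₀ _ _ hd h hg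
  have m1 : Measurable fun f : ({k} : Finset ℕ) → G => f ⟨k, by simp⟩ := measurable_pi_apply _
  have m2 : Measurable fun (f : (I.image fun j => k + 1 + j : Finset ℕ) → G) (i : I) =>
      f ⟨k + 1 + i, Finset.mem_image_of_mem _ i.2⟩ :=
    measurable_pi_lambda _ fun i => measurable_pi_apply _
  exact this.comp m1 m2

/-- Independence from the whole future sequence, not just from the next sample, is what makes the
induction close. -/
theorem chain_indepFun {f : S × G → S} (hf : Measurable f) {X : ℕ → Ω → S} {g : ℕ → Ω → G}
    (hX : ∀ k ω, X (k + 1) ω = f (X k ω, g k ω)) (hX0 : AEMeasurable (X 0) P)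
    (hg : ∀ k, AEMeasurable (g k) P) (hgi : iIndepFun g P)
    (h0 : IndepFun (X 0) (fun ω k => g k ω) P) (k : ℕ) :
    AEMeasurable (X k) P ∧ IndepFun (X k) (fun ω (j : ℕ) => g (k + j) ω) P := by
  induction k with
  | zero => exact ⟨hX0, by simpa using h0⟩
  | succ k ih =>
    obtain ⟨hm, hi⟩ := ih
    have hXk : X (k + 1) = fun ω => f (X k ω, g k ω) := funext (hX k)
    have htail : AEMeasurable (fun ω (j : ℕ) => g (k + 1 + j) ω) P :=
      aemeasurable_pi_lambda _ fun j => hg _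
    have h1 : IndepFun (X k) (fun ω => (g k ω, fun j : ℕ => g (k + 1 + j) ω)) P := by
      have := hi.comp (φ := id) (ψ := fun a : ℕ → G => (a 0, fun j => a (j + 1))) measurable_id
        (by fun_prop)
      convert! this using 1
      funext ω
      simp [Nat.add_assoc, Nat.add_comm 1]
    have h2 := indepFun_prodMk_of_indepFun hm (hg k) htail h1 (iIndepFun.indepFun_tail hg hgi k)
    rw [hXk]
    exact ⟨hf.comp_aemeasurable (hm.prodMk (hg k)), h2.comp hf measurable_id⟩

theorem chain_hasLaw_prod {f : S × G → S} (hf : Measurable f) {X : ℕ → Ω → S} {g : ℕ → Ω → G}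
    (hX : ∀ k ω, X (k + 1) ω = f (X k ω, g k ω)) (hX0 : AEMeasurable (X 0) P)
    {γ : Measure G} (hg : ∀ k, HasLaw (g k) γ P) (hgi : iIndepFun g P)
    (h0 : IndepFun (X 0) (fun ω k => g k ω) P) (k : ℕ) :
    HasLaw (fun ω => (X k ω, g k ω)) ((P.map (X k)).prod γ) P := by
  obtain ⟨hm, hi⟩ := chain_indepFun hf hX hX0 (fun k => (hg k).aemeasurable) hgi h0 k
  refine ⟨hm.prodMk (hg k).aemeasurable, ?_⟩
  have m0 : Measurable fun a : ℕ → G => a 0 := measurable_pi_apply 0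
  have := hi.comp measurable_id m0
  have := (indepFun_iff_map_prod_eq_prod_map_map hm (hg k).aemeasurable).1
    (by simpa [Function.comp_def] using this)
  rw [this, (hg k).map_eq]

/-- A property of state and sample that holds for almost every sample in every state of an invariant
set holds almost surely along the whole chain. -/
theorem chain_ae_forall {f : S × G → S} (hf : Measurable f) {X : ℕ → Ω → S} {g : ℕ → Ω → G}
    (hX : ∀ k ω, X (k + 1) ω = f (X k ω, g k ω)) (hX0 : AEMeasurable (X 0) P)
    {γ : Measure G} [IsProbabilityMeasure γ] (hg : ∀ k, HasLaw (g k) γ P) (hgi : iIndepFun g P)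
    (h0 : IndepFun (X 0) (fun ω k => g k ω) P) {I : Set S} {Q : Set (S × G)}
    (hI : MeasurableSet I) (hQ : MeasurableSet Q)
    (hinv : ∀ s ∈ I, ∀ᵐ x ∂γ, (s, x) ∈ Q ∧ f (s, x) ∈ I) (hstart : ∀ᵐ ω ∂P, X 0 ω ∈ I) :
    ∀ᵐ ω ∂P, ∀ k, X k ω ∈ I ∧ (X k ω, g k ω) ∈ Q := by
  have hR : MeasurableSet {p : S × G | p.1 ∈ I → p ∈ Q ∧ f p ∈ I} := by
    have : {p : S × G | p.1 ∈ I → p ∈ Q ∧ f p ∈ I} = (Prod.fst ⁻¹' I)ᶜ ∪ (Q ∩ f ⁻¹' I) := by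
      ext p
      simp [imp_iff_not_or]
    rw [this]
    exact (measurable_fst hI).compl.union (hQ.inter (hf hI))
  have hstep : ∀ k, ∀ᵐ ω ∂P, X k ω ∈ I → (X k ω, g k ω) ∈ Q ∧ X (k + 1) ω ∈ I := by
    intro k
    have hl := chain_hasLaw_prod hf hX hX0 hg hgi h0 k
    have hp : ∀ᵐ p ∂((P.map (X k)).prod γ), p.1 ∈ I → p ∈ Q ∧ f p ∈ I := by
      rw [Measure.ae_prod_iff_ae_ae hR]
      refine Eventually.of_forall fun s => ?_
      by_cases hs : s ∈ I
      · filter_upwards [hinv s hs] with x hx _ using hx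
      · exact Eventually.of_forall fun x h => absurd h hs
    rw [← hl.map_eq, ae_map_iff hl.aemeasurable hR] at hp
    filter_upwards [hp] with ω h
    rwa [hX k ω]
  filter_upwards [hstart, ae_all_iff.2 hstep] with ω h0 hk
  have hall : ∀ k, X k ω ∈ I := fun k => Nat.rec h0 (fun k ih => (hk k ih).2) k
  exact fun k => ⟨hall k, (hk k (hall k)).1⟩

/-- If the increments of a bounded quantity dominate `F (X k, g k)`, then the expectation of `F`
over a fresh sample tends to zero along the chain. -/
theorem chain_tendsto_lintegral {f : S × G → S} (hf : Measurable f) {X : ℕ → Ω → S}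
    {g : ℕ → Ω → G} (hX : ∀ k ω, X (k + 1) ω = f (X k ω, g k ω)) (hX0 : AEMeasurable (X 0) P)
    {γ : Measure G} [IsProbabilityMeasure γ] (hg : ∀ k, HasLaw (g k) γ P) (hgi : iIndepFun g P)
    (h0 : IndepFun (X 0) (fun ω k => g k ω) P) {F : S × G → ENNReal} (hF : Measurable F)
    {C : ENNReal} (hC : C ≠ ⊤) (hsum : ∀ᵐ ω ∂P, ∑' k, F (X k ω, g k ω) ≤ C) :
    ∀ᵐ ω ∂P, Tendsto (fun k => ∫⁻ x, F (X k ω, x) ∂γ) atTop (𝓝 0) := by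
  have hl := chain_hasLaw_prod hf hX hX0 hg hgi h0
  have hm : ∀ k, AEMeasurable (X k) P := fun k => measurable_fst.comp_aemeasurable (hl k).aemeasurable
  have hΦ : Measurable fun s => ∫⁻ x, F (s, x) ∂γ := hF.lintegral_prod_right'
  -- The joint law of state and sample is a product, so the sample can be integrated out first.
  have e : ∀ k, ∫⁻ ω, F (X k ω, g k ω) ∂P = ∫⁻ ω, ∫⁻ x, F (X k ω, x) ∂γ ∂P := by
    intro k
    rw [← lintegral_map' (f := fun p => F p) hF.aemeasurable (hl k).aemeasurable, (hl k).map_eq,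
      lintegral_prod _ hF.aemeasurable, lintegral_map' hΦ.aemeasurable (hm k)]
  have hΦX : ∀ k, AEMeasurable (fun ω => ∫⁻ x, F (X k ω, x) ∂γ) P := fun k =>
    hΦ.comp_aemeasurable (hm k)
  have hFX : ∀ k, AEMeasurable (fun ω => F (X k ω, g k ω)) P := fun k =>
    hF.comp_aemeasurable (hl k).aemeasurable
  have hfin : ∫⁻ ω, ∑' k, ∫⁻ x, F (X k ω, x) ∂γ ∂P ≠ ⊤ := by
    rw [lintegral_tsum hΦX]
    simp_rw [← e]
    rw [← lintegral_tsum hFX]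
    refine ne_top_of_le_ne_top hC ((lintegral_mono_ae hsum).trans ?_)
    simp
  have := ae_lt_top' (AEMeasurable.tsum hΦX) hfin
  filter_upwards [this] with ω hω
  exact ENNReal.tendsto_atTop_zero_of_tsum_ne_top hω.ne

end Markov

/-! ### Null sets of the Gaussian. -/

section Gaussian

theorem pi_absolutelyContinuous {α : Type*} [MeasurableSpace α] {μ ν : Measure α} [SigmaFinite μ]
    [SigmaFinite ν] (h : μ ≪ ν) (n : ℕ) :
    Measure.pi (fun _ : Fin n => μ) ≪ Measure.pi (fun _ : Fin n => ν) := by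
  induction n with
  | zero => rw [Measure.pi_of_empty, Measure.pi_of_empty]
  | succ n ih =>
    rw [← (measurePreserving_piFinSuccAbove (fun _ : Fin (n + 1) => μ) 0).symm.map_eq,
      ← (measurePreserving_piFinSuccAbove (fun _ : Fin (n + 1) => ν) 0).symm.map_eq]
    exact (h.prod ih).map (MeasurableEquiv.measurable _)

theorem stdGaussian_absolutelyContinuous (n : ℕ) : stdGaussian (E n) ≪ volume := by
  rw [← map_pi_eq_stdGaussian, ← (PiLp.volume_preserving_toLp (Fin n)).map_eq]
  exact (pi_absolutelyContinuous (gaussianReal_absolutelyContinuous 0 one_ne_zero) n).map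
    (PiLp.volume_preserving_toLp (Fin n)).measurable

theorem absolutelyContinuous_stdGaussian (n : ℕ) : volume ≪ stdGaussian (E n) := by
  rw [← map_pi_eq_stdGaussian, ← (PiLp.volume_preserving_toLp (Fin n)).map_eq]
  exact (pi_absolutelyContinuous (gaussianReal_absolutelyContinuous' 0 one_ne_zero) n).map
    (PiLp.volume_preserving_toLp (Fin n)).measurable

instance (n : ℕ) : (stdGaussian (E n)).IsOpenPosMeasure :=
  (absolutelyContinuous_stdGaussian n).isOpenPosMeasure

theorem ae_stdGaussian_notMem_submodule {n : ℕ} {W : Submodule ℝ (E n)} (hW : W ≠ ⊤) :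
    ∀ᵐ y ∂stdGaussian (E n), y ∉ W :=
  (stdGaussian_absolutelyContinuous n).ae_le
    (measure_eq_zero_iff_ae_notMem.1 (Measure.addHaar_submodule volume W hW))

theorem finite_quadratic_roots {α : ℝ} (hα : α ≠ 0) (β γ : ℝ) :
    {t : ℝ | α * t ^ 2 + β * t + γ = 0}.Finite := by
  have hp : (Polynomial.C α * Polynomial.X ^ 2 + Polynomial.C β * Polynomial.X
      + Polynomial.C γ) ≠ 0 := by
    intro h
    have := congrArg (fun p => Polynomial.coeff p 2) h
    simp at this
    exact hα this
  refine (Polynomial.finite_setOfPred_isRoot hp).subset fun t ht => ?_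
  simpa [Polynomial.IsRoot] using ht

/-- Fubini along the lines parallel to `e`: each meets the zero set in at most two points, since the
leading coefficient is nonzero. -/
theorem ae_ne_zero_of_quadratic_on_lines {n : ℕ} {Q : E n → ℝ} (hQ : Measurable Q) (e : E n)
    {α : ℝ} (hα : α ≠ 0) (h : ∀ y, ∃ β γ : ℝ, ∀ t : ℝ, Q (y + t • e) = α * t ^ 2 + β * t + γ) :
    ∀ᵐ y : E n, Q y ≠ 0 := by
  have hs : MeasurableSet {y | Q y ≠ 0} := (hQ (measurableSet_singleton 0)).compl
  refine ae_mem_of_ae_add_linearMap_mem (LinearMap.toSpanSingleton ℝ (E n) e) volume volume hs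
    fun y => ?_
  obtain ⟨β, γ, hy⟩ := h y
  have := (finite_quadratic_roots hα β γ).measure_zero volume
  filter_upwards [measure_eq_zero_iff_ae_notMem.1 this] with t ht
  change Q (y + t • e) ≠ 0
  rw [hy]
  exact ht

end Gaussian

/-! ### Random directions orthogonal to a unit vector. -/

section Direction

variable {n : ℕ} {c g : E n}

theorem inner_direction_self (hc : ‖c‖ = 1) (g : E n) : (inner ℝ c (direction c g) : ℝ) = 0 := by
  simp [direction, inner_smul_right, inner_sub_right, real_inner_comm, hc]

theorem norm_direction (h : g - (inner ℝ g c : ℝ) • c ≠ 0) : ‖direction c g‖ = 1 := by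
  rw [direction, norm_smul, norm_inv, norm_norm, inv_mul_cancel₀ (norm_ne_zero_iff.2 h)]

theorem direction_of_orthogonal (hg : ‖g‖ = 1) (h : (inner ℝ g c : ℝ) = 0) :
    direction c g = g := by
  simp [direction, h, hg]

theorem eq_add_norm_smul_direction (c g : E n) :
    g = (inner ℝ g c : ℝ) • c + ‖g - (inner ℝ g c : ℝ) • c‖ • direction c g := by
  by_cases h : g - (inner ℝ g c : ℝ) • c = 0
  · simp only [h, norm_zero, zero_smul, add_zero]
    exact sub_eq_zero.1 h
  · rw [direction, smul_smul, mul_inv_cancel₀ (norm_ne_zero_iff.2 h), one_smul,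
      add_sub_cancel]

theorem measurable_direction {α : Type*} [MeasurableSpace α] {φ ψ : α → E n} (hφ : Measurable φ)
    (hψ : Measurable ψ) : Measurable fun a => direction (φ a) (ψ a) := by
  unfold direction
  fun_prop

theorem continuousAt_direction {α : Type*} [TopologicalSpace α] {φ ψ : α → E n} {a : α}
    (hφ : ContinuousAt φ a) (hψ : ContinuousAt ψ a)
    (h : ψ a - (inner ℝ (ψ a) (φ a) : ℝ) • φ a ≠ 0) :
    ContinuousAt (fun a => direction (φ a) (ψ a)) a := by
  unfold direction
  have h1 : ContinuousAt (fun a => ψ a - (inner ℝ (ψ a) (φ a) : ℝ) • φ a) a := by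
    fun_prop
  exact (h1.norm.inv₀ (norm_ne_zero_iff.2 h)).smul h1

theorem ae_norm_direction (hn : 2 ≤ n) (c : E n) :
    ∀ᵐ g ∂stdGaussian (E n), g - (inner ℝ g c : ℝ) • c ≠ 0 := by
  have hW : Submodule.span ℝ {c} ≠ ⊤ := by
    intro h
    have h1 := finrank_span_le_card (R := ℝ) ({c} : Set (E n))
    rw [h, finrank_top, finrank_euclideanSpace_fin] at h1
    simp at h1
    omega
  filter_upwards [ae_stdGaussian_notMem_submodule hW] with g hg h
  exact hg (Submodule.mem_span_singleton.2 ⟨_, (sub_eq_zero.1 h).symm⟩)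

theorem exists_orthogonal_pair (hn : 3 ≤ n) (s c : E n) :
    ∃ e : E n, ‖e‖ = 1 ∧ (inner ℝ e s : ℝ) = 0 ∧ (inner ℝ e c : ℝ) = 0 := by
  classical
  set W : Submodule ℝ (E n) := Submodule.span ℝ ({s, c} : Finset (E n))
  have hW : Wᗮ ≠ ⊥ := by
    intro h
    have h1 := finrank_span_le_card (R := ℝ) (({s, c} : Finset (E n)) : Set (E n))
    rw [Submodule.orthogonal_eq_bot_iff] at h
    change Module.finrank ℝ W ≤ _ at h1
    rw [h, finrank_top, finrank_euclideanSpace_fin, Set.toFinset_card] at h1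
    have h2 : Fintype.card (({s, c} : Finset (E n)) : Set (E n)) ≤ 2 := by
      simpa using Finset.card_le_two (a := s) (b := c)
    omega
  obtain ⟨e, he, he0⟩ := Submodule.exists_mem_ne_zero_of_ne_bot hW
  have hn0 := norm_ne_zero_iff.2 he0
  refine ⟨‖e‖⁻¹ • e, by rw [norm_smul, norm_inv, norm_norm, inv_mul_cancel₀ hn0], ?_, ?_⟩
  · rw [inner_smul_left, (Submodule.mem_orthogonal' W e).1 he s (Submodule.subset_span (by simp)),
      mul_zero]
  · rw [inner_smul_left, (Submodule.mem_orthogonal' W e).1 he c (Submodule.subset_span (by simp)),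
      mul_zero]

/-- Clearing the normalization turns equality into the quadratic equation ⟨y, s⟩² = r²(‖y‖² - ⟨y,
c⟩²), whose solutions form a null set. In the plane the direction takes only two values up to null
sets, hence the restriction to r = 0 or n ≥ 3. -/
theorem ae_inner_direction_ne (hc : ‖c‖ = 1) {s : E n} (hs : s ≠ 0)
    (hsc : (inner ℝ s c : ℝ) = 0) {r : ℝ} (h : r = 0 ∨ 3 ≤ n) :
    ∀ᵐ g ∂stdGaussian (E n), (inner ℝ (direction c g) s : ℝ) ≠ r := by
  set Q : E n → ℝ := fun y => (inner ℝ y s : ℝ) ^ 2 - r ^ 2 * (‖y‖ ^ 2 - (inner ℝ y c : ℝ) ^ 2)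
  have hQm : Measurable Q := by fun_prop
  -- `Q` is itself a quadratic form, so `Q e` is its leading coefficient along `e`. A vector
  -- orthogonal to both `s` and `c` gives -r².
  obtain ⟨e, he⟩ : ∃ e, Q e ≠ 0 := by
    by_cases hr : r = 0
    · refine ⟨s, ?_⟩
      simp [Q, hr, hs]
    · obtain ⟨e, he1, he2, he3⟩ := exists_orthogonal_pair (h.resolve_left hr) s c
      exact ⟨e, by simp [Q, he1, he2, he3, hr]⟩
  have hQ : ∀ᵐ y : E n, Q y ≠ 0 := by
    refine ae_ne_zero_of_quadratic_on_lines hQm e he fun y => ?_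
    refine ⟨2 * (inner ℝ y s : ℝ) * inner ℝ e s
      - r ^ 2 * (2 * inner ℝ y e - 2 * inner ℝ y c * inner ℝ e c), Q y, fun t => ?_⟩
    simp only [Q, inner_add_left, inner_smul_left, ← real_inner_self_eq_norm_sq, inner_add_right,
      inner_smul_right, real_inner_comm y e, conj_trivial]
    ring
  filter_upwards [(stdGaussian_absolutelyContinuous n).ae_le hQ] with g hg hr
  apply hg
  have e1 : (inner ℝ g s : ℝ) = ‖g - (inner ℝ g c : ℝ) • c‖ * r := by
    conv_lhs => rw [eq_add_norm_smul_direction c g]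
    rw [inner_add_left, inner_smul_left, inner_smul_left, real_inner_comm s c, hsc, hr]
    simp
  have e2 : ‖g - (inner ℝ g c : ℝ) • c‖ ^ 2 = ‖g‖ ^ 2 - (inner ℝ g c : ℝ) ^ 2 := by
    rw [norm_sub_sq_real, norm_smul, inner_smul_right, hc, Real.norm_eq_abs, mul_one, sq_abs]
    ring
  simp only [Q]
  rw [e1, ← e2]
  ring

end Direction

/-! ### Rayleigh quotients of symmetric 2×2 matrices. -/

section PlaneRayleigh

/-- The largest eigenvalue of the symmetric matrix `!![a, b / 2; b / 2, c]`. -/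
noncomputable def topEigenvalue (a b c : ℝ) : ℝ := (a + c) / 2 + √(((a - c) / 2) ^ 2 + (b / 2) ^ 2)

variable (a b c : ℝ)

theorem le_topEigenvalue_left : a ≤ topEigenvalue a b c := by
  have : |(a - c) / 2| ≤ √(((a - c) / 2) ^ 2 + (b / 2) ^ 2) := Real.abs_le_sqrt (by nlinarith)
  have := le_abs_self ((a - c) / 2)
  unfold topEigenvalue
  linarith

theorem le_topEigenvalue_right : c ≤ topEigenvalue a b c := by
  have : |(a - c) / 2| ≤ √(((a - c) / 2) ^ 2 + (b / 2) ^ 2) := Real.abs_le_sqrt (by nlinarith)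
  have := neg_abs_le ((a - c) / 2)
  unfold topEigenvalue
  linarith

theorem topEigenvalue_charpoly :
    (topEigenvalue a b c - a) * (topEigenvalue a b c - c) = (b / 2) ^ 2 := by
  have : √(((a - c) / 2) ^ 2 + (b / 2) ^ 2) ^ 2 = ((a - c) / 2) ^ 2 + (b / 2) ^ 2 :=
    Real.sq_sqrt (by positivity)
  unfold topEigenvalue
  linear_combination this

variable {a b c}

theorem topEigenvalue_of_le (h : c ≤ a) : topEigenvalue a 0 c = a := by
  have : √(((a - c) / 2) ^ 2) = (a - c) / 2 := Real.sqrt_sq (by linarith)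
  simp [topEigenvalue, this]
  ring

theorem lt_topEigenvalue_left (h : b ≠ 0 ∨ a < c) : a < topEigenvalue a b c := by
  rcases h with h | h
  · have h1 := topEigenvalue_charpoly a b c
    have h2 : 0 < (b / 2) ^ 2 := by positivity
    refine lt_of_le_of_ne (le_topEigenvalue_left a b c) fun h3 => ?_
    rw [← h3, sub_self, zero_mul] at h1
    exact h2.ne h1
  · exact h.trans_le (le_topEigenvalue_right a b c)

theorem lt_topEigenvalue_right (h : b ≠ 0) : c < topEigenvalue a b c := by
  have h1 := topEigenvalue_charpoly a b c
  have h2 : 0 < (b / 2) ^ 2 := by positivity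
  refine lt_of_le_of_ne (le_topEigenvalue_right a b c) fun h3 => ?_
  rw [← h3, sub_self, mul_zero] at h1
  exact h2.ne h1

variable (a b c)

/-- With l the top eigenvalue the claim is tb ≤ (l - a) + t²(l - c), which is the inequality of
arithmetic and geometric means because (l - a)(l - c) = (b/2)². -/
theorem plane_quotient_le (t : ℝ) :
    (a + t * b + t ^ 2 * c) / (1 + t ^ 2) ≤ topEigenvalue a b c := by
  rw [div_le_iff₀ (by positivity)]
  have h1 := topEigenvalue_charpoly a b c
  have h2 := le_topEigenvalue_left a b c
  have h3 := le_topEigenvalue_right a b c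
  set l := topEigenvalue a b c
  have h4 : |t * (b / 2)| ≤ ((l - a) + t ^ 2 * (l - c)) / 2 := by
    apply abs_le_of_sq_le_sq
    · rw [mul_pow, ← h1]
      nlinarith [sq_nonneg ((l - a) - t ^ 2 * (l - c))]
    · have := mul_nonneg (sq_nonneg t) (sub_nonneg.2 h3)
      linarith
  have := le_abs_self (t * (b / 2))
  nlinarith

/-- The step that attains the largest eigenvalue, `0` if `b = 0`. -/
noncomputable def planeStep : ℝ := 2 * (topEigenvalue a b c - a) / b

variable {a b c}

theorem plane_quotient_planeStep (h : b ≠ 0 ∨ c ≤ a) :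
    (a + planeStep a b c * b + planeStep a b c ^ 2 * c) / (1 + planeStep a b c ^ 2)
      = topEigenvalue a b c := by
  by_cases hb : b = 0
  · have hca := h.resolve_left (not_not.2 hb)
    subst hb
    simp [planeStep, topEigenvalue_of_le hca]
  · rw [div_eq_iff (by positivity)]
    have h1 := topEigenvalue_charpoly a b c
    unfold planeStep
    set l := topEigenvalue a b c
    field_simp
    linear_combination (-4) * (l - a) * h1

theorem planeStep_unique (h : b ≠ 0 ∨ c < a) {t : ℝ}
    (ht : (a + t * b + t ^ 2 * c) / (1 + t ^ 2) = topEigenvalue a b c) :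
    t = planeStep a b c := by
  rw [div_eq_iff (by positivity)] at ht
  by_cases hb : b = 0
  · have hca := h.resolve_left (not_not.2 hb)
    subst hb
    simp only [planeStep, div_zero]
    rw [topEigenvalue_of_le hca.le] at ht
    have : t ^ 2 * (a - c) = 0 := by linarith
    rcases mul_eq_zero.1 this with h | h
    · simpa using h
    · linarith
  · have h1 := topEigenvalue_charpoly a b c
    have h2 := lt_topEigenvalue_right (a := a) (c := c) hb
    unfold planeStep
    set l := topEigenvalue a b c
    -- Equality in the bound, multiplied by l - c, is a perfect square.
    have h3 : ((l - c) * t - b / 2) ^ 2 = 0 := by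
      linear_combination (-(l - c)) * ht - h1
    have h4 : (l - c) * t = b / 2 := by
      have := pow_eq_zero_iff (two_ne_zero) |>.1 h3
      linarith
    rw [eq_div_iff hb]
    have : (l - c) * (t * b - 2 * (l - a)) = 0 := by
      linear_combination b * h4 - 2 * h1
    rcases mul_eq_zero.1 this with h | h
    · linarith
    · linarith

end PlaneRayleigh

/-! ### The optimal step in closed form. -/

section ExplicitStep

variable {d m : ℕ} (B : E d →L[ℝ] E m)

/-- The bilinear form `⟨u, B v⟩` at the pair `p = (u, v)`. -/
noncomputable def pairing (p : E m × E d) : ℝ := inner ℝ p.1 (B p.2)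

/-- The mixed term `⟨w, B v⟩ + ⟨u, B x⟩` of the pairs `p = (u, v)` and `q = (w, x)`. -/
noncomputable def crossPairing (p q : E m × E d) : ℝ := inner ℝ q.1 (B p.2) + inner ℝ p.1 (B q.2)

/-- The pair of search directions at `p` obtained from the sample `g`. -/
noncomputable def directions (p g : E m × E d) : E m × E d :=
  (direction p.1 g.1, direction p.2 g.2)

/-- The value of the objective after an optimal step from `s.1` with the sample `s.2`. -/
noncomputable def nextValue (s : (E m × E d) × (E m × E d)) : ℝ :=
  topEigenvalue (pairing B s.1) (crossPairing B s.1 (directions s.1 s.2))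
    (pairing B (directions s.1 s.2))

/-- The closed form of the optimal step size in the state `s.1` with the sample `s.2`. -/
noncomputable def explicitStepSize (s : (E m × E d) × (E m × E d)) : ℝ :=
  planeStep (pairing B s.1) (crossPairing B s.1 (directions s.1 s.2))
    (pairing B (directions s.1 s.2))

/-- One iteration with the closed form of the step size. -/
noncomputable def explicitStep (s : (E m × E d) × (E m × E d)) : E m × E d :=
  (√(1 + explicitStepSize B s ^ 2))⁻¹ • (s.1 + explicitStepSize B s • directions s.1 s.2)

/-- The sample yields unit search directions along which the objective has a maximizer. -/
def IsRegular (s : (E m × E d) × (E m × E d)) : Prop :=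
  (s.2.1 - (inner ℝ s.2.1 s.1.1 : ℝ) • s.1.1 ≠ 0 ∧ s.2.2 - (inner ℝ s.2.2 s.1.2 : ℝ) • s.1.2 ≠ 0) ∧
    (crossPairing B s.1 (directions s.1 s.2) ≠ 0 ∨
      pairing B (directions s.1 s.2) ≤ pairing B s.1)

/-- Pairs of unit vectors with nonnegative objective. -/
def unitPairs : Set (E m × E d) := {p | ‖p.1‖ = 1 ∧ ‖p.2‖ = 1 ∧ 0 ≤ pairing B p}

variable {B}

theorem measurable_pairing : Measurable (pairing B) := by
  unfold pairing; fun_prop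

theorem continuous_pairing : Continuous (pairing B) := by
  unfold pairing; fun_prop

theorem measurable_directions :
    Measurable fun s : (E m × E d) × (E m × E d) => directions s.1 s.2 := by
  have h1 : Measurable fun s : (E m × E d) × (E m × E d) => direction s.1.1 s.2.1 :=
    measurable_direction measurable_fst.fst measurable_snd.fst
  have h2 : Measurable fun s : (E m × E d) × (E m × E d) => direction s.1.2 s.2.2 :=
    measurable_direction measurable_fst.snd measurable_snd.snd
  exact h1.prodMk h2

theorem measurable_crossPairing_directions :
    Measurable fun s : (E m × E d) × (E m × E d) => crossPairing B s.1 (directions s.1 s.2) := by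
  have h1 := (measurable_directions (m := m) (d := d)).fst
  have h2 := (measurable_directions (m := m) (d := d)).snd
  exact (h1.inner (B.measurable.comp measurable_fst.snd)).add
    (measurable_fst.fst.inner (B.measurable.comp h2))

theorem measurable_pairing_directions :
    Measurable fun s : (E m × E d) × (E m × E d) => pairing B (directions s.1 s.2) :=
  measurable_pairing.comp measurable_directions

theorem measurable_nextValue : Measurable (nextValue B) := by
  have h1 := measurable_crossPairing_directions (B := B)
  have h2 := measurable_pairing_directions (B := B)
  have h3 := measurable_pairing (B := B)
  unfold nextValue topEigenvalue
  fun_prop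

theorem measurable_explicitStepSize : Measurable (explicitStepSize B) := by
  have h1 := measurable_crossPairing_directions (B := B)
  have h2 := measurable_nextValue (B := B)
  have h3 := measurable_pairing (B := B)
  unfold nextValue at h2
  unfold explicitStepSize planeStep
  fun_prop

theorem measurable_explicitStep : Measurable (explicitStep B) := by
  have h1 := measurable_explicitStepSize (B := B)
  have h2 := measurable_directions (m := m) (d := d)
  unfold explicitStep
  fun_prop

theorem measurableSet_isRegular : MeasurableSet {s | IsRegular B s} := by
  have h1 := measurable_crossPairing_directions (B := B)
  have h2 := measurable_pairing_directions (B := B)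
  have h3 := measurable_pairing (B := B)
  unfold IsRegular
  refine (MeasurableSet.inter ?_ ?_).inter (MeasurableSet.union ?_ ?_)
  · exact (measurableSet_eq_fun (by fun_prop) (by fun_prop)).compl
  · exact (measurableSet_eq_fun (by fun_prop) (by fun_prop)).compl
  · exact (measurableSet_eq_fun (by fun_prop) (by fun_prop)).compl
  · exact measurableSet_le h2 (by fun_prop)

theorem isCompact_unitPairs : IsCompact (unitPairs B) := by
  have : unitPairs B = (Metric.sphere 0 1 ×ˢ Metric.sphere 0 1) ∩ {p | 0 ≤ pairing B p} := by
    ext p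
    simp [unitPairs, and_assoc]
  rw [this]
  exact ((isCompact_sphere _ _).prod (isCompact_sphere _ _)).inter_right
    (isClosed_le continuous_const continuous_pairing)

theorem continuousAt_nextValue {s : (E m × E d) × (E m × E d)}
    (h : s.2.1 - (inner ℝ s.2.1 s.1.1 : ℝ) • s.1.1 ≠ 0 ∧
      s.2.2 - (inner ℝ s.2.2 s.1.2 : ℝ) • s.1.2 ≠ 0) : ContinuousAt (nextValue B) s := by
  have h1 : ContinuousAt (fun s : (E m × E d) × (E m × E d) => direction s.1.1 s.2.1) s :=
    continuousAt_direction continuousAt_fst.fst continuousAt_snd.fst h.1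
  have h2 : ContinuousAt (fun s : (E m × E d) × (E m × E d) => direction s.1.2 s.2.2) s :=
    continuousAt_direction continuousAt_fst.snd continuousAt_snd.snd h.2
  unfold nextValue topEigenvalue crossPairing pairing directions
  have h3 := Real.continuous_sqrt
  fun_prop

theorem abs_pairing_le {p : E m × E d} (h1 : ‖p.1‖ = 1) (h2 : ‖p.2‖ = 1) :
    |pairing B p| ≤ ‖B‖ := by
  have := abs_real_inner_le_norm p.1 (B p.2)
  have h3 := B.le_opNorm p.2
  rw [h1, one_mul] at this
  rw [h2, mul_one] at h3
  exact this.trans h3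

theorem pairing_le_norm {p : E m × E d} (h1 : ‖p.1‖ = 1) (h2 : ‖p.2‖ = 1) :
    pairing B p ≤ ‖B‖ := (le_abs_self _).trans (abs_pairing_le h1 h2)

theorem pairing_add_smul (p q : E m × E d) (t : ℝ) :
    pairing B (p + t • q) = pairing B p + t * crossPairing B p q + t ^ 2 * pairing B q := by
  simp [pairing, crossPairing, inner_add_left, inner_add_right, inner_smul_left, inner_smul_right]
  ring

theorem pairing_smul (p : E m × E d) (t : ℝ) : pairing B (t • p) = t ^ 2 * pairing B p := by
  simp [pairing, inner_smul_left, inner_smul_right]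
  ring

theorem norm_sq_add_smul {n : ℕ} {u w : E n} (hu : ‖u‖ = 1) (hw : ‖w‖ = 1)
    (h : (inner ℝ u w : ℝ) = 0) (t : ℝ) : ‖u + t • w‖ = √(1 + t ^ 2) := by
  rw [eq_comm, Real.sqrt_eq_iff_mul_self_eq (by positivity) (norm_nonneg _), ← pow_two,
    norm_add_sq_real, hu, norm_smul, inner_smul_right, h, hw]
  simp

theorem lineObjective_eq {A V : E d →L[ℝ] E m} {p q : E m × E d} (hp1 : ‖p.1‖ = 1)
    (hp2 : ‖p.2‖ = 1) (hq1 : ‖q.1‖ = 1) (hq2 : ‖q.2‖ = 1) (h1 : (inner ℝ p.1 q.1 : ℝ) = 0)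
    (h2 : (inner ℝ p.2 q.2 : ℝ) = 0) (t : ℝ) :
    lineObjective A V p.1 p.2 q.1 q.2 t = (pairing (A - V) p + t * crossPairing (A - V) p q
      + t ^ 2 * pairing (A - V) q) / (1 + t ^ 2) := by
  rw [← pairing_add_smul, lineObjective, norm_sq_add_smul hp1 hq1 h1, norm_sq_add_smul hp2 hq2 h2,
    Real.mul_self_sqrt (by positivity)]
  rfl

theorem stepSize_eq {A V : E d →L[ℝ] E m} {p q : E m × E d} (hp1 : ‖p.1‖ = 1)
    (hp2 : ‖p.2‖ = 1) (hq1 : ‖q.1‖ = 1) (hq2 : ‖q.2‖ = 1) (h1 : (inner ℝ p.1 q.1 : ℝ) = 0)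
    (h2 : (inner ℝ p.2 q.2 : ℝ) = 0)
    (h : crossPairing (A - V) p q ≠ 0 ∨ pairing (A - V) q ≤ pairing (A - V) p) :
    stepSize A V p.1 p.2 q.1 q.2 = planeStep (pairing (A - V) p) (crossPairing (A - V) p q)
        (pairing (A - V) q) ∧
      IsOptimalStep A V p.1 p.2 q.1 q.2 (stepSize A V p.1 p.2 q.1 q.2) := by
  have hl := lineObjective_eq (A := A) (V := V) hp1 hp2 hq1 hq2 h1 h2
  set a := pairing (A - V) p
  set b := crossPairing (A - V) p q
  set c := pairing (A - V) q
  have hopt : IsOptimalStep A V p.1 p.2 q.1 q.2 (planeStep a b c) := by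
    intro t
    rw [hl, hl, plane_quotient_planeStep h]
    exact plane_quotient_le a b c t
  have key : stepSize A V p.1 p.2 q.1 q.2 = planeStep a b c := by
    unfold stepSize
    split_ifs with hu
    · exact hu.unique hu.choose_spec.1 hopt
    · by_contra hne
      -- The maximizer fails to be unique only for a constant objective; then both formulas return
      -- 0.
      have hbc : b = 0 ∧ c = a := by
        by_contra hbc
        apply hu
        have h' : b ≠ 0 ∨ c < a := by
          rcases h with h | h
          · exact Or.inl h
          · by_cases hb : b = 0
            · exact Or.inr (lt_of_le_of_ne h fun hc => hbc ⟨hb, hc⟩)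
            · exact Or.inl hb
        refine ⟨_, hopt, fun t ht => planeStep_unique h' (le_antisymm (plane_quotient_le a b c t) ?_)⟩
        rw [← plane_quotient_planeStep h, ← hl, ← hl]
        exact ht _
      exact hne (by simp [planeStep, hbc.1])
  exact ⟨key, key ▸ hopt⟩

theorem directions_spec {p g : E m × E d} (hp1 : ‖p.1‖ = 1) (hp2 : ‖p.2‖ = 1)
    (h : g.1 - (inner ℝ g.1 p.1 : ℝ) • p.1 ≠ 0 ∧ g.2 - (inner ℝ g.2 p.2 : ℝ) • p.2 ≠ 0) :
    ‖(directions p g).1‖ = 1 ∧ ‖(directions p g).2‖ = 1 ∧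
      (inner ℝ p.1 (directions p g).1 : ℝ) = 0 ∧ (inner ℝ p.2 (directions p g).2 : ℝ) = 0 :=
  ⟨norm_direction h.1, norm_direction h.2, inner_direction_self hp1 _, inner_direction_self hp2 _⟩

/-- `stepSize` is defined by choice, while the closed form is visibly measurable. The probabilistic
arguments run on the closed form and are transferred back through this equality. -/
theorem step_eq_explicitStep {A V : E d →L[ℝ] E m} {p g : E m × E d} (hp1 : ‖p.1‖ = 1)
    (hp2 : ‖p.2‖ = 1) (h : IsRegular (A - V) (p, g)) :
    step A V p g = explicitStep (A - V) (p, g) ∧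
      IsOptimalStep A V p.1 p.2 (directions p g).1 (directions p g).2
        (stepSize A V p.1 p.2 (directions p g).1 (directions p g).2) := by
  obtain ⟨h1, h2, h3, h4⟩ := directions_spec hp1 hp2 h.1
  obtain ⟨h5, h6⟩ := stepSize_eq hp1 hp2 h1 h2 h3 h4 h.2
  refine ⟨?_, h6⟩
  change ((√(1 + (stepSize A V p.1 p.2 (directions p g).1 (directions p g).2) ^ 2))⁻¹ •
    (p.1 + (stepSize A V p.1 p.2 (directions p g).1 (directions p g).2) • (directions p g).1),
    (√(1 + (stepSize A V p.1 p.2 (directions p g).1 (directions p g).2) ^ 2))⁻¹ •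
    (p.2 + (stepSize A V p.1 p.2 (directions p g).1 (directions p g).2) • (directions p g).2)) = _
  rw [h5]
  rfl

theorem norm_explicitStep {s : (E m × E d) × (E m × E d)} (hp1 : ‖s.1.1‖ = 1) (hp2 : ‖s.1.2‖ = 1)
    (h : s.2.1 - (inner ℝ s.2.1 s.1.1 : ℝ) • s.1.1 ≠ 0 ∧
      s.2.2 - (inner ℝ s.2.2 s.1.2 : ℝ) • s.1.2 ≠ 0) :
    ‖(explicitStep B s).1‖ = 1 ∧ ‖(explicitStep B s).2‖ = 1 := by
  obtain ⟨h1, h2, h3, h4⟩ := directions_spec hp1 hp2 h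
  have h0 : √(1 + explicitStepSize B s ^ 2) ≠ 0 := (Real.sqrt_pos.2 (by positivity)).ne'
  constructor
  · simp only [explicitStep, Prod.smul_fst, Prod.fst_add]
    rw [norm_smul, norm_sq_add_smul hp1 h1 h3, norm_inv, Real.norm_of_nonneg (Real.sqrt_nonneg _),
      inv_mul_cancel₀ h0]
  · simp only [explicitStep, Prod.smul_snd, Prod.snd_add]
    rw [norm_smul, norm_sq_add_smul hp2 h2 h4, norm_inv, Real.norm_of_nonneg (Real.sqrt_nonneg _),
      inv_mul_cancel₀ h0]

theorem pairing_explicitStep {s : (E m × E d) × (E m × E d)} (h : IsRegular B s) :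
    pairing B (explicitStep B s) = nextValue B s := by
  rw [explicitStep, pairing_smul, pairing_add_smul, inv_pow, Real.sq_sqrt (by positivity),
    inv_mul_eq_div]
  exact plane_quotient_planeStep h.2

theorem explicitStep_mem_unitPairs {s : (E m × E d) × (E m × E d)} (hs : s.1 ∈ unitPairs B)
    (h : IsRegular B s) : explicitStep B s ∈ unitPairs B := by
  obtain ⟨h1, h2⟩ := norm_explicitStep (B := B) hs.1 hs.2.1 h.1
  refine ⟨h1, h2, ?_⟩
  rw [pairing_explicitStep h]
  exact hs.2.2.trans (le_topEigenvalue_left _ _ _)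

/-- As x ⊥ v, the inner product is 1/√(1 + τ²). This later prevents sign flips of v^k. -/
theorem inner_explicitStep_snd_nonneg {s : (E m × E d) × (E m × E d)} (hp2 : ‖s.1.2‖ = 1) :
    0 ≤ (inner ℝ s.1.2 (explicitStep B s).2 : ℝ) := by
  simp only [explicitStep, Prod.smul_snd, Prod.snd_add]
  rw [inner_smul_right, inner_add_right, inner_smul_right, real_inner_self_eq_norm_sq, hp2,
    directions, inner_direction_self hp2]
  simp

end ExplicitStep

/-! ### Ascent directions below the operator norm. -/

section TopSingular

variable {d m : ℕ} {B : E d →L[ℝ] E m}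

/-- The conditions `B v = a u`, `B* u = a v` with `a = ⟨u, B v⟩` on the pair `p = (u, v)`. -/
def IsStationary (B : E d →L[ℝ] E m) (p : E m × E d) : Prop :=
  B p.2 = pairing B p • p.1 ∧ ContinuousLinearMap.adjoint B p.1 = pairing B p • p.2

theorem exists_norm_eq_opNorm (hd : 0 < d) (B : E d →L[ℝ] E m) : ∃ e, ‖e‖ = 1 ∧ ‖B e‖ = ‖B‖ := by
  have : Nonempty (Fin d) := ⟨⟨0, hd⟩⟩
  obtain ⟨e, he, hmax⟩ := (isCompact_sphere (0 : E d) 1).exists_isMaxOn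
    (NormedSpace.sphere_nonempty.2 zero_le_one) (f := fun x => ‖B x‖) (by fun_prop)
  have he1 : ‖e‖ = 1 := by simpa using he
  refine ⟨e, he1, le_antisymm (by simpa [he1] using B.le_opNorm e) ?_⟩
  refine B.opNorm_le_of_unit_norm (norm_nonneg _) fun x hx => hmax (by simpa using hx)

/-- Expanding ‖B*Be - ‖B‖²e‖² and using ‖B*Be‖ ≤ ‖B‖² shows that it is at most 0. -/
theorem adjoint_apply_of_norm_eq {e : E d} (he : ‖e‖ = 1) (h : ‖B e‖ = ‖B‖) :
    ContinuousLinearMap.adjoint B (B e) = ‖B‖ ^ 2 • e := by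
  have h1 : ‖ContinuousLinearMap.adjoint B (B e)‖ ≤ ‖B‖ ^ 2 := by
    have := (ContinuousLinearMap.adjoint B).le_opNorm (B e)
    rw [LinearIsometryEquiv.norm_map, h] at this
    linarith
  have h2 : ‖ContinuousLinearMap.adjoint B (B e) - ‖B‖ ^ 2 • e‖ ^ 2 ≤ 0 := by
    rw [norm_sub_sq_real, norm_smul, inner_smul_right, ContinuousLinearMap.adjoint_inner_left,
      real_inner_self_eq_norm_sq, he, h, norm_pow, norm_norm]
    have := pow_le_pow_left₀ (norm_nonneg _) h1 2
    linarith
  have h3 := pow_eq_zero_iff two_ne_zero |>.1 (le_antisymm h2 (sq_nonneg _))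
  exact sub_eq_zero.1 (norm_eq_zero.1 h3)

theorem exists_unit_orthogonal {n : ℕ} (hn : 2 ≤ n) (v : E n) :
    ∃ x : E n, ‖x‖ = 1 ∧ (inner ℝ v x : ℝ) = 0 := by
  have hW : (Submodule.span ℝ {v})ᗮ ≠ ⊥ := by
    intro h
    rw [Submodule.orthogonal_eq_bot_iff] at h
    have h1 := finrank_span_le_card (R := ℝ) ({v} : Set (E n))
    rw [h, finrank_top, finrank_euclideanSpace_fin] at h1
    simp at h1
    omega
  obtain ⟨x, hx, hx0⟩ := Submodule.exists_mem_ne_zero_of_ne_bot hW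
  refine ⟨‖x‖⁻¹ • x, ?_, ?_⟩
  · rw [norm_smul, norm_inv, norm_norm, inv_mul_cancel₀ (norm_ne_zero_iff.2 hx0)]
  · rw [inner_smul_right, Submodule.mem_orthogonal_singleton_iff_inner_right.1 hx, mul_zero]

theorem eq_inner_smul_of_forall_orthogonal {n : ℕ} {u r : E n} (hu : ‖u‖ = 1)
    (h : ∀ w : E n, ‖w‖ = 1 → (inner ℝ u w : ℝ) = 0 → (inner ℝ w r : ℝ) = 0) :
    r = (inner ℝ u r : ℝ) • u := by
  by_contra hne
  have h0 := norm_ne_zero_iff.2 (sub_ne_zero.2 hne)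
  set z := r - (inner ℝ u r : ℝ) • u
  have hz : (inner ℝ u z : ℝ) = 0 := by
    simp [z, inner_sub_right, inner_smul_right, hu]
  have h1 := h (‖z‖⁻¹ • z) (by rw [norm_smul, norm_inv, norm_norm, inv_mul_cancel₀ h0])
    (by rw [inner_smul_right, hz, mul_zero])
  rw [inner_smul_left, mul_eq_zero] at h1
  have h2 : (inner ℝ z r : ℝ) = 0 := h1.resolve_left (by simpa using h0)
  have h3 : (inner ℝ z z : ℝ) = 0 := by
    conv_lhs => rw [show z = r - (inner ℝ u r : ℝ) • u from rfl]
    rw [inner_sub_left, inner_smul_left, hz, real_inner_comm, h2]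
    simp
  rw [real_inner_self_eq_norm_sq] at h3
  exact h0 (pow_eq_zero_iff two_ne_zero |>.1 h3)

theorem inner_adjoint_eq_pairing (p : E m × E d) :
    (inner ℝ p.2 (ContinuousLinearMap.adjoint B p.1) : ℝ) = pairing B p := by
  rw [ContinuousLinearMap.adjoint_inner_right, real_inner_comm, pairing]

/-- Below the operator norm some pair of unit directions increases the objective. -/
theorem exists_increasing_directions (hd : 2 ≤ d) (hm : 2 ≤ m) {p : E m × E d}
    (hp : p ∈ unitPairs B) (hlt : pairing B p < ‖B‖) :
    ∃ q : E m × E d, ‖q.1‖ = 1 ∧ ‖q.2‖ = 1 ∧ (inner ℝ p.1 q.1 : ℝ) = 0 ∧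
      (inner ℝ p.2 q.2 : ℝ) = 0 ∧ (crossPairing B p q ≠ 0 ∨ pairing B p < pairing B q) := by
  by_contra! hcon
  obtain ⟨hu, hv, ha⟩ := hp
  have key : ∀ w x, ‖w‖ = 1 → ‖x‖ = 1 → (inner ℝ p.1 w : ℝ) = 0 → (inner ℝ p.2 x : ℝ) = 0 →
      (inner ℝ w (B p.2) : ℝ) = 0 ∧ (inner ℝ p.1 (B x) : ℝ) = 0 := by
    intro w x h1 h2 h3 h4
    have e1 := (hcon (w, x) h1 h2 h3 h4).1
    -- Replacing x by -x changes the sign of one summand of b, so both summands vanish.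
    have e2 := (hcon (w, -x) h1 (by simpa using h2) h3 (by simpa using h4)).1
    simp only [crossPairing, map_neg, inner_neg_right] at e1 e2
    constructor <;> linarith
  obtain ⟨w0, hw0, hw0'⟩ := exists_unit_orthogonal hm p.1
  obtain ⟨x0, hx0, hx0'⟩ := exists_unit_orthogonal hd p.2
  have hB : B p.2 = pairing B p • p.1 :=
    eq_inner_smul_of_forall_orthogonal hu fun w h1 h2 => (key w x0 h1 hx0 h2 hx0').1
  have hB' : ContinuousLinearMap.adjoint B p.1 = pairing B p • p.2 := by
    rw [← inner_adjoint_eq_pairing]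
    refine eq_inner_smul_of_forall_orthogonal hv fun x h1 h2 => ?_
    rw [ContinuousLinearMap.adjoint_inner_right, real_inner_comm]
    exact (key w0 x hw0 h1 hw0' h2).2
  set a := pairing B p
  obtain ⟨e, he, hBe⟩ := exists_norm_eq_opNorm (by omega) B
  have hBB := adjoint_apply_of_norm_eq he hBe
  have hpos : 0 < ‖B‖ := ha.trans_lt hlt
  -- v and e belong to the different eigenvalues a² and ‖B‖² of B*B, hence are orthogonal.
  have o1 : (inner ℝ p.1 (B e) : ℝ) = a * inner ℝ p.2 e := by
    rw [← ContinuousLinearMap.adjoint_inner_left, hB', inner_smul_left]; rfl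
  have o2 : ‖B‖ ^ 2 * (inner ℝ p.2 e : ℝ) = a * (a * inner ℝ p.2 e) := by
    rw [← o1, ← inner_smul_right, ← hBB, ContinuousLinearMap.adjoint_inner_right, hB,
      inner_smul_left]; rfl
  have o3 : (inner ℝ p.2 e : ℝ) = 0 := by
    have : (‖B‖ ^ 2 - a ^ 2) * (inner ℝ p.2 e : ℝ) = 0 := by linear_combination o2
    refine (mul_eq_zero.1 this).resolve_left ?_
    have := pow_lt_pow_left₀ hlt ha two_ne_zero
    linarith
  have := (hcon (‖B‖⁻¹ • B e, e) (by rw [norm_smul, norm_inv, norm_norm, hBe,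
    inv_mul_cancel₀ hpos.ne']) he (by rw [inner_smul_right, o1, o3]; simp) o3).2
  simp only [pairing, inner_smul_left, real_inner_self_eq_norm_sq, hBe] at this
  have h2 : ‖B‖⁻¹ * ‖B‖ ^ 2 = ‖B‖ := by field_simp
  simp only [conj_trivial] at this
  rw [h2] at this
  exact absurd hlt (not_lt.2 this)

end TopSingular

/-! ### Almost sure convergence of the objective. -/

section Convergence

variable {d m : ℕ} {B : E d →L[ℝ] E m}

/-- No continuity of φ is required: the expected gain is controlled only through sequences, by
Fatou's lemma. -/
theorem tendsto_of_isCompact_of_forall_seq {X : Type*} [TopologicalSpace X] [FirstCountableTopology X]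
    {K : Set X} (hK : IsCompact K) {φ : X → ENNReal} {ψ : X → ℝ} (hψ : Continuous ψ) {L : ℝ}
    (h : ∀ s ∈ K, ∀ y : ℕ → X, Tendsto y atTop (𝓝 s) → Tendsto (fun k => φ (y k)) atTop (𝓝 0) →
      ψ s = L) {x : ℕ → X} (hx : ∀ k, x k ∈ K)
    (hφ : Tendsto (fun k => φ (x k)) atTop (𝓝 0)) : Tendsto (fun k => ψ (x k)) atTop (𝓝 L) := by
  refine tendsto_of_subseq_tendsto fun ns hns => ?_
  obtain ⟨s, hs, ι, hι, hlim⟩ := hK.tendsto_subseq (x := fun k => x (ns k)) fun k => hx _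
  refine ⟨ι, ?_⟩
  have := h s hs (fun k => x (ns (ι k))) hlim (hφ.comp (hns.comp hι.tendsto_atTop))
  rw [← this]
  exact (hψ.tendsto s).comp hlim

variable (B) in
/-- The increase of the objective in one optimal step. -/
noncomputable def gain (s : (E m × E d) × (E m × E d)) : ENNReal :=
  ENNReal.ofReal (nextValue B s - pairing B s.1)

theorem measurable_gain : Measurable (gain B) :=
  ENNReal.measurable_ofReal.comp (measurable_nextValue.sub (measurable_pairing.comp measurable_fst))

theorem continuousAt_gain {s : (E m × E d) × (E m × E d)}
    (h : s.2.1 - (inner ℝ s.2.1 s.1.1 : ℝ) • s.1.1 ≠ 0 ∧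
      s.2.2 - (inner ℝ s.2.2 s.1.2 : ℝ) • s.1.2 ≠ 0) : ContinuousAt (gain B) s :=
  ENNReal.continuous_ofReal.continuousAt.comp
    ((continuousAt_nextValue h).sub (continuous_pairing.comp continuous_fst).continuousAt)

theorem ae_directions_nondegenerate (hd : 2 ≤ d) (hm : 2 ≤ m) (p : E m × E d) :
    ∀ᵐ g ∂((stdGaussian (E m)).prod (stdGaussian (E d))),
      g.1 - (inner ℝ g.1 p.1 : ℝ) • p.1 ≠ 0 ∧ g.2 - (inner ℝ g.2 p.2 : ℝ) • p.2 ≠ 0 :=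
  (Measure.quasiMeasurePreserving_fst.ae (ae_norm_direction hm p.1)).and
    (Measure.quasiMeasurePreserving_snd.ae (ae_norm_direction hd p.2))

theorem pairing_eq_norm_of_tendsto_lintegral_gain (hd : 2 ≤ d) (hm : 2 ≤ m) {s : E m × E d}
    (hs : s ∈ unitPairs B) {y : ℕ → E m × E d} (hy : Tendsto y atTop (𝓝 s))
    (h : Tendsto (fun k => ∫⁻ g, gain B (y k, g) ∂((stdGaussian (E m)).prod (stdGaussian (E d))))
      atTop (𝓝 0)) : pairing B s = ‖B‖ := by
  set γ := (stdGaussian (E m)).prod (stdGaussian (E d))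
  by_contra hne
  have hlt := lt_of_le_of_ne (pairing_le_norm (B := B) hs.1 hs.2.1) hne
  obtain ⟨q, h1, h2, h3, h4, h5⟩ := exists_increasing_directions hd hm hs hlt
  have hzero : ∀ᵐ g ∂γ, gain B (s, g) = 0 := by
    -- The gain is continuous wherever the projected samples do not vanish, hence at (s, g) for
    -- almost every g.
    have hpt : ∀ᵐ g ∂γ, gain B (s, g) = liminf (fun k => gain B (y k, g)) atTop := by
      filter_upwards [ae_directions_nondegenerate hd hm s] with g hg
      have hc : ContinuousAt (gain B) (s, g) := continuousAt_gain hg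
      exact (hc.tendsto.comp (hy.prodMk_nhds tendsto_const_nhds)).liminf_eq.symm
    have hint : ∫⁻ g, gain B (s, g) ∂γ = 0 := by
      refine le_antisymm ?_ zero_le
      rw [lintegral_congr_ae hpt, ← h.liminf_eq]
      exact lintegral_liminf_le fun k => measurable_gain.comp measurable_prodMk_left
    exact (lintegral_eq_zero_iff (measurable_gain.comp measurable_prodMk_left)).1 hint
  have hq : q.1 - (inner ℝ q.1 s.1 : ℝ) • s.1 ≠ 0 ∧ q.2 - (inner ℝ q.2 s.2 : ℝ) • s.2 ≠ 0 := by
    rw [real_inner_comm, h3, real_inner_comm, h4]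
    simp [← norm_ne_zero_iff, h1, h2]
  -- Read as a sample, the pair `q` reproduces itself as search directions; the gain is therefore
  -- positive near `q`, on a set of positive Gaussian measure.
  have hdir : directions s q = q := by
    unfold directions
    rw [direction_of_orthogonal h1 (by rw [real_inner_comm, h3]),
      direction_of_orthogonal h2 (by rw [real_inner_comm, h4])]
  have hpos : 0 < gain B (s, q) := by
    rw [gain, ENNReal.ofReal_pos, sub_pos, nextValue, hdir]
    exact lt_topEigenvalue_left h5
  have hcont : ContinuousAt (fun g => gain B (s, g)) q :=
    (continuousAt_gain (s := (s, q)) hq).comp (f := fun g => (s, g)) (by fun_prop)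
  have hnhds : {g | 0 < gain B (s, g)} ∈ 𝓝 q := hcont.eventually (lt_mem_nhds hpos)
  have hmeas := Measure.measure_pos_of_mem_nhds γ hnhds
  have : γ {g | 0 < gain B (s, g)} = 0 := by
    rw [measure_eq_zero_iff_ae_notMem]
    filter_upwards [hzero] with g hg
    simp [hg]
  exact hmeas.ne' this

variable {Ω : Type*} [MeasurableSpace Ω] {P : Measure Ω} [IsProbabilityMeasure P]

theorem ae_regular_and_tendsto (hd : 2 ≤ d) (hm : 2 ≤ m) {I : Set (E m × E d)}
    (hI : MeasurableSet I) (hIU : I ⊆ unitPairs B)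
    (hinv : ∀ p ∈ I, ∀ᵐ g ∂((stdGaussian (E m)).prod (stdGaussian (E d))),
      IsRegular B (p, g) ∧ explicitStep B (p, g) ∈ I)
    {X g : ℕ → Ω → E m × E d} (hX : ∀ k ω, X (k + 1) ω = explicitStep B (X k ω, g k ω))
    (hX0 : AEMeasurable (X 0) P)
    (hg : ∀ k, HasLaw (g k) ((stdGaussian (E m)).prod (stdGaussian (E d))) P)
    (hgi : iIndepFun g P) (h0 : IndepFun (X 0) (fun ω k => g k ω) P)
    (hstart : ∀ᵐ ω ∂P, X 0 ω ∈ I) :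
    (∀ᵐ ω ∂P, ∀ k, X k ω ∈ I ∧ IsRegular B (X k ω, g k ω)) ∧
      ∀ᵐ ω ∂P, Tendsto (fun k => pairing B (X k ω)) atTop (𝓝 ‖B‖) := by
  have hreg := chain_ae_forall measurable_explicitStep hX hX0 hg hgi h0 hI
    (measurableSet_isRegular (B := B)) hinv hstart
  refine ⟨hreg, ?_⟩
  have hsum : ∀ᵐ ω ∂P, ∑' k, gain B (X k ω, g k ω) ≤ ENNReal.ofReal ‖B‖ := by
    filter_upwards [hreg] with ω hω
    refine ENNReal.tsum_le_of_sum_range_le fun n => ?_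
    have hterm : ∀ k, gain B (X k ω, g k ω)
        = ENNReal.ofReal (pairing B (X (k + 1) ω) - pairing B (X k ω)) := by
      intro k
      rw [gain, hX, pairing_explicitStep (hω k).2]
    have hnn : ∀ k ∈ Finset.range n, 0 ≤ pairing B (X (k + 1) ω) - pairing B (X k ω) := by
      intro k _
      rw [hX, pairing_explicitStep (hω k).2, sub_nonneg]
      exact le_topEigenvalue_left _ _ _
    simp_rw [hterm]
    -- The gains telescope; a nonnegative initial value bounds the sum by ‖B‖.
    rw [← ENNReal.ofReal_sum_of_nonneg hnn, Finset.sum_range_sub fun k => pairing B (X k ω)]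
    apply ENNReal.ofReal_le_ofReal
    have h1 := hIU (hω n).1
    have h2 := (hIU (hω 0).1).2.2
    have h3 := pairing_le_norm (B := B) h1.1 h1.2.1
    linarith
  have hlim := chain_tendsto_lintegral measurable_explicitStep hX hX0 hg hgi h0
    (measurable_gain (B := B)) ENNReal.ofReal_ne_top hsum
  filter_upwards [hreg, hlim] with ω h1 h2
  exact tendsto_of_isCompact_of_forall_seq
    (φ := fun p => ∫⁻ g, gain B (p, g) ∂((stdGaussian (E m)).prod (stdGaussian (E d))))
    isCompact_unitPairs continuous_pairing
    (fun s hs y hy hφ => pairing_eq_norm_of_tendsto_lintegral_gain hd hm hs hy hφ)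
    (fun k => hIU (h1 k).1) h2

end Convergence

/-! ### Avoiding singular pairs when max(m, d) ≥ 3. -/

section NonsingularStates

variable {d m : ℕ} {B : E d →L[ℝ] E m}

/-- The eigenspace of `B* B` to the eigenvalue `μ ^ 2`. -/
noncomputable def singularSpace (B : E d →L[ℝ] E m) (μ : ℝ) : Submodule ℝ (E d) :=
  Module.End.eigenspace ((ContinuousLinearMap.adjoint B ∘L B : E d →L[ℝ] E d) : E d →ₗ[ℝ] E d)
    (μ ^ 2)

theorem mem_singularSpace {μ : ℝ} {v : E d} :
    v ∈ singularSpace B μ ↔ ContinuousLinearMap.adjoint B (B v) = μ ^ 2 • v := by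
  simp [singularSpace]

theorem mem_singularSpace_of_pair {μ : ℝ} {u : E m} {v : E d} (h1 : B v = μ • u)
    (h2 : ContinuousLinearMap.adjoint B u = μ • v) : v ∈ singularSpace B μ := by
  rw [mem_singularSpace, h1, map_smul, h2, smul_smul, pow_two]

theorem singularSpace_ne_top (hd : 0 < d) {μ : ℝ} (h0 : 0 ≤ μ) (h : μ < ‖B‖) :
    singularSpace B μ ≠ ⊤ := by
  intro htop
  obtain ⟨e, he, hBe⟩ := exists_norm_eq_opNorm hd B
  have h1 : e ∈ singularSpace B μ := htop ▸ Submodule.mem_top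
  rw [mem_singularSpace, adjoint_apply_of_norm_eq he hBe] at h1
  have he0 : e ≠ 0 := by
    rw [← norm_ne_zero_iff, he]
    exact one_ne_zero
  exact (pow_lt_pow_left₀ h h0 two_ne_zero).ne' (smul_left_injective ℝ he0 h1)

variable (B) in
theorem finite_singularValues : {μ : ℝ | 0 ≤ μ ∧ singularSpace B μ ≠ ⊥}.Finite := by
  set f : Module.End ℝ (E d) := ((ContinuousLinearMap.adjoint B ∘L B : E d →L[ℝ] E d) : E d →ₗ[ℝ] E d)
  refine Set.Finite.of_finite_image (f := fun μ : ℝ => μ ^ 2)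
    ((Module.End.finite_hasEigenvalue f).subset ?_) ?_
  · rintro _ ⟨μ, hμ, rfl⟩
    exact hμ.2
  · intro μ hμ ν hν h
    exact (pow_left_inj₀ hμ.1 hν.1 two_ne_zero).1 h

variable (B) in
/-- The directions `w` for which some step from `(u, v)` along `(w, x)` leads to a pair of singular
vectors to a positive singular value other than the largest one. -/
def badDirections (u : E m) (v x : E d) : Set (E m) :=
  {w | ∃ τ μ : ℝ, τ ≠ 0 ∧ 0 < μ ∧ μ < ‖B‖ ∧ B (v + τ • x) = μ • (u + τ • w) ∧
    ContinuousLinearMap.adjoint B (u + τ • w) = μ • (v + τ • x)}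

/-- There are finitely many candidates μ. For each of them two different steps τ would put x, and
then v, into the singular space, which `hx` excludes. Once τ ≠ 0 and μ > 0 are fixed, Bv + τBx = μ(u
+ τw) determines w. -/
theorem finite_badDirections {u : E m} {v x : E d} (hv : v ≠ 0) (hvx : (inner ℝ v x : ℝ) = 0)
    (hx : ∀ μ ∈ {μ : ℝ | 0 ≤ μ ∧ singularSpace B μ ≠ ⊥}, μ < ‖B‖ → v ∈ singularSpace B μ →
      x ∉ singularSpace B μ) : (badDirections B u v x).Finite := by
  have hsub : badDirections B u v x ⊆ ⋃ μ ∈ {μ : ℝ | 0 ≤ μ ∧ singularSpace B μ ≠ ⊥},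
      {w | 0 < μ ∧ μ < ‖B‖ ∧ ∃ τ : ℝ, τ ≠ 0 ∧ B (v + τ • x) = μ • (u + τ • w) ∧
        v + τ • x ∈ singularSpace B μ} := by
    rintro w ⟨τ, μ, hτ, hμ, hμB, h1, h2⟩
    have hmem := mem_singularSpace_of_pair h1 h2
    have hne : v + τ • x ≠ 0 := by
      intro h
      have : (inner ℝ v (v + τ • x) : ℝ) = 0 := by rw [h, inner_zero_right]
      rw [inner_add_right, inner_smul_right, hvx, mul_zero, add_zero] at this
      exact hv (inner_self_eq_zero.1 this)
    exact Set.mem_biUnion ⟨hμ.le, (Submodule.ne_bot_iff _).2 ⟨_, hmem, hne⟩⟩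
      ⟨hμ, hμB, τ, hτ, h1, hmem⟩
  refine ((finite_singularValues B).biUnion fun μ hμ => Set.Subsingleton.finite ?_).subset hsub
  rintro w ⟨hμ0, hμB, τ, hτ, h1, h2⟩ w' ⟨-, -, τ', hτ', h1', h2'⟩
  have hττ : τ = τ' := by
    by_contra hne
    have hxm : x ∈ singularSpace B μ := by
      have h3 := (singularSpace B μ).sub_mem h2 h2'
      rw [add_sub_add_left_eq_sub, ← sub_smul] at h3
      exact (Submodule.smul_mem_iff _ (sub_ne_zero.2 hne)).1 h3
    refine hx μ hμ hμB ?_ hxm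
    exact (Submodule.add_mem_iff_left _ (Submodule.smul_mem _ _ hxm)).1 h2
  subst hττ
  have h3 := smul_right_injective (E m) hμ0.ne' (h1.symm.trans h1')
  exact smul_right_injective (E m) hτ (add_left_cancel h3)

/-- The sample lies in the span of v and x, and almost surely avoids the finitely many proper
singular spaces. So v and x are not both in one of them. -/
theorem ae_finite_badDirections (hd : 2 ≤ d) (u : E m) {v : E d} (hv : ‖v‖ = 1) :
    ∀ᵐ y ∂stdGaussian (E d), (badDirections B u v (direction v y)).Finite := by
  have h : ∀ᵐ y ∂stdGaussian (E d), ∀ μ ∈ {μ : ℝ | 0 ≤ μ ∧ singularSpace B μ ≠ ⊥},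
      μ < ‖B‖ → y ∉ singularSpace B μ := by
    rw [ae_ball_iff (finite_singularValues B).countable]
    intro μ hμ
    by_cases hB : μ < ‖B‖
    · filter_upwards [ae_stdGaussian_notMem_submodule
        (singularSpace_ne_top (by omega) hμ.1 hB)] with y hy _ using hy
    · exact Eventually.of_forall fun y h => absurd h hB
  filter_upwards [h] with y hy
  refine finite_badDirections (by rw [← norm_ne_zero_iff, hv]; exact one_ne_zero)
    (inner_direction_self hv y) fun μ hμ hB hvm hxm => hy μ hμ hB ?_
  rw [eq_add_norm_smul_direction v y]
  exact Submodule.add_mem _ (Submodule.smul_mem _ _ hvm) (Submodule.smul_mem _ _ hxm)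

theorem ae_direction_notMem_finite {n : ℕ} (hn : 3 ≤ n) {c : E n} (hc : ‖c‖ = 1) {S : Set (E n)}
    (hS : S.Finite) : ∀ᵐ g ∂stdGaussian (E n), direction c g ∉ S := by
  have h : ∀ᵐ g ∂stdGaussian (E n), ∀ w ∈ S, direction c g ≠ w := by
    rw [ae_ball_iff hS.countable]
    intro w _
    obtain ⟨s, hs, hcs⟩ := exists_unit_orthogonal (by omega : 2 ≤ n) c
    have hs0 : s ≠ 0 := by
      rw [← norm_ne_zero_iff, hs]
      exact one_ne_zero
    filter_upwards [ae_inner_direction_ne hc hs0 (by rw [real_inner_comm, hcs])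
      (r := inner ℝ w s) (Or.inr hn)] with g hg hw
    exact hg (by rw [hw])
  filter_upwards [h] with g hg hmem using hg _ hmem rfl

theorem ae_prod_of_ae_ae {α β : Type*} [MeasurableSpace α] [MeasurableSpace β] {μ : Measure α}
    {ν : Measure β} [SFinite μ] [SFinite ν] {s : Set (α × β)} (hs : MeasurableSet s)
    (h : ∀ᵐ y ∂ν, ∀ᵐ x ∂μ, (x, y) ∈ s) : ∀ᵐ p ∂μ.prod ν, p ∈ s := by
  rw [← Measure.prod_swap]
  refine (ae_map_iff measurable_swap.aemeasurable hs).2 ?_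
  exact (Measure.ae_prod_iff_ae_ae (measurable_swap hs)).2 h

theorem crossPairing_directions_eq {p : E m × E d} (hu : ‖p.1‖ = 1) (hv : ‖p.2‖ = 1)
    (g : E m × E d) : crossPairing B p (directions p g) =
      inner ℝ (direction p.1 g.1) (B p.2 - pairing B p • p.1) +
      inner ℝ (direction p.2 g.2) (ContinuousLinearMap.adjoint B p.1 - pairing B p • p.2) := by
  rw [inner_sub_right, inner_sub_right, inner_smul_right, inner_smul_right,
    real_inner_comm p.1 (direction _ _), inner_direction_self hu,
    real_inner_comm p.2 (direction _ _), inner_direction_self hv,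
    ContinuousLinearMap.adjoint_inner_right, real_inner_comm p.1 (B _), crossPairing]
  simp [directions]

/-- The cross term is ⟨w, r⟩ + ⟨x, t⟩ with the residuals r = Bv - au and t = B*u - av, not both
zero. One sample is frozen and the other, acting on a nonzero residual, has to avoid a single value.
That value is 0 if the frozen side has zero residual; otherwise the moving side needs dimension at
least 3. -/
theorem ae_crossPairing_ne_zero (h3 : 3 ≤ max m d) {p : E m × E d}
    (hu : ‖p.1‖ = 1) (hv : ‖p.2‖ = 1) (hp : ¬ IsStationary B p) :
    ∀ᵐ g ∂((stdGaussian (E m)).prod (stdGaussian (E d))),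
      crossPairing B p (directions p g) ≠ 0 := by
  have hmeas : MeasurableSet {g | crossPairing B p (directions p g) ≠ 0} :=
    ((measurable_crossPairing_directions.comp measurable_prodMk_left)
      (measurableSet_singleton 0)).compl
  have hr : (inner ℝ (B p.2 - pairing B p • p.1) p.1 : ℝ) = 0 := by
    rw [inner_sub_left, inner_smul_left, real_inner_self_eq_norm_sq, hu, real_inner_comm, pairing]
    simp
  have ht : (inner ℝ (ContinuousLinearMap.adjoint B p.1 - pairing B p • p.2) p.2 : ℝ) = 0 := by
    rw [inner_sub_left, inner_smul_left, real_inner_self_eq_norm_sq, hv, real_inner_comm,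
      inner_adjoint_eq_pairing]
    simp
  have hcross := crossPairing_directions_eq (B := B) hu hv
  set r := B p.2 - pairing B p • p.1 with hrdef
  set t := ContinuousLinearMap.adjoint B p.1 - pairing B p • p.2 with htdef
  have hrt : r ≠ 0 ∨ t ≠ 0 := by
    by_contra! h
    exact hp ⟨sub_eq_zero.1 h.1, sub_eq_zero.1 h.2⟩
  by_cases hright : r ≠ 0 ∧ (t = 0 ∨ 3 ≤ m)
  · refine ae_prod_of_ae_ae hmeas (Eventually.of_forall fun y => ?_)
    filter_upwards [ae_inner_direction_ne hu hright.1 hr (r := -inner ℝ (direction p.2 y) t)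
      (hright.2.imp (fun h => by rw [h]; simp) id)] with z hz
    change crossPairing B p (directions p (z, y)) ≠ 0
    rw [hcross]
    exact fun h => hz (eq_neg_of_add_eq_zero_left h)
  · have hleft : t ≠ 0 ∧ (r = 0 ∨ 3 ≤ d) := by
      rw [le_max_iff] at h3
      tauto
    refine (Measure.ae_prod_iff_ae_ae hmeas).2 (Eventually.of_forall fun z => ?_)
    filter_upwards [ae_inner_direction_ne hv hleft.1 ht (r := -inner ℝ (direction p.1 z) r)
      (hleft.2.imp (fun h => by rw [h]; simp) id)] with y hy
    rw [hcross]
    exact fun h => hy (eq_neg_of_add_eq_zero_right h)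

/-- Pairs of unit vectors with nonnegative objective which are not singular pairs, unless the
objective is already maximal. -/
def nonsingularPairs (B : E d →L[ℝ] E m) : Set (E m × E d) :=
  {p | p ∈ unitPairs B ∧ (pairing B p = ‖B‖ ∨ ¬ IsStationary B p)}

theorem measurableSet_isStationary : MeasurableSet {p | IsStationary B p} := by
  have h1 : Measurable fun p : E m × E d => B p.2 := by fun_prop
  have h2 : Measurable fun p : E m × E d => ContinuousLinearMap.adjoint B p.1 := by fun_prop
  have h3 := measurable_pairing (B := B)
  exact (measurableSet_eq_fun h1 (h3.smul measurable_fst)).inter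
    (measurableSet_eq_fun h2 (h3.smul measurable_snd))

theorem measurableSet_nonsingularPairs : MeasurableSet (nonsingularPairs B) :=
  (isCompact_unitPairs.isClosed.measurableSet).inter
    ((measurable_pairing (measurableSet_singleton _)).union measurableSet_isStationary.compl)

/-- The singular vector equations are homogeneous, so the normalization cancels. A nonzero cross
term makes the gain strict, whence τ ≠ 0 and μ > 0. The two memberships are the same fact for B and
for B*. -/
theorem mem_badDirections_of_isStationary {s : (E m × E d) × (E m × E d)}
    (hreg : IsRegular B s) (hcross : crossPairing B s.1 (directions s.1 s.2) ≠ 0)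
    (hs : s.1 ∈ unitPairs B) (hne : pairing B (explicitStep B s) ≠ ‖B‖)
    (hst : IsStationary B (explicitStep B s)) :
    (directions s.1 s.2).1 ∈ badDirections B s.1.1 s.1.2 (directions s.1 s.2).2 ∧
    (directions s.1 s.2).2 ∈ badDirections (ContinuousLinearMap.adjoint B) s.1.2 s.1.1
      (directions s.1 s.2).1 := by
  have hmem := explicitStep_mem_unitPairs hs hreg
  have hlt := lt_of_le_of_ne (pairing_le_norm (B := B) hmem.1 hmem.2.1) hne
  have hgt : pairing B s.1 < nextValue B s := lt_topEigenvalue_left (Or.inl hcross)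
  have hτ : explicitStepSize B s ≠ 0 :=
    div_ne_zero (mul_ne_zero two_ne_zero (sub_ne_zero.2 hgt.ne')) hcross
  have hpos : 0 < pairing B (explicitStep B s) := by
    rw [pairing_explicitStep hreg]
    exact hs.2.2.trans_lt hgt
  have h0 : (√(1 + explicitStepSize B s ^ 2))⁻¹ ≠ 0 :=
    (inv_pos.2 (Real.sqrt_pos.2 (by positivity))).ne'
  obtain ⟨h1, h2⟩ := hst
  set μ := pairing B (explicitStep B s)
  simp only [explicitStep, Prod.smul_fst, Prod.fst_add, Prod.smul_snd, Prod.snd_add] at h1 h2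
  rw [map_smul, smul_comm μ] at h1 h2
  have h1' := smul_right_injective (E m) h0 h1
  have h2' := smul_right_injective (E d) h0 h2
  refine ⟨⟨_, μ, hτ, hpos, hlt, h1', h2'⟩, ⟨_, μ, hτ, hpos, ?_, h2', ?_⟩⟩
  · rwa [LinearIsometryEquiv.norm_map]
  · rwa [ContinuousLinearMap.adjoint_adjoint]

theorem ae_explicitStep_mem_nonsingularPairs (hd : 2 ≤ d) (hm : 2 ≤ m) (h3 : 3 ≤ max m d)
    {p : E m × E d} (hp : p ∈ nonsingularPairs B) :
    ∀ᵐ g ∂((stdGaussian (E m)).prod (stdGaussian (E d))),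
      IsRegular B (p, g) ∧ explicitStep B (p, g) ∈ nonsingularPairs B := by
  obtain ⟨hU, hp⟩ := hp
  have hnd := ae_directions_nondegenerate hd hm p
  by_cases htop : pairing B p = ‖B‖
  · filter_upwards [hnd] with g hg
    obtain ⟨h1, h2, -, -⟩ := directions_spec hU.1 hU.2.1 hg
    have hreg : IsRegular B (p, g) := ⟨hg, Or.inr (by rw [htop]; exact pairing_le_norm h1 h2)⟩
    have hmem := explicitStep_mem_unitPairs (s := (p, g)) hU hreg
    refine ⟨hreg, hmem, Or.inl (le_antisymm (pairing_le_norm hmem.1 hmem.2.1) ?_)⟩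
    rw [pairing_explicitStep hreg, ← htop]
    exact le_topEigenvalue_left _ _ _
  have hcross := ae_crossPairing_ne_zero h3 hU.1 hU.2.1 (hp.resolve_left htop)
  set N : Set (E m × E d) := {g | IsRegular B (p, g) →
    crossPairing B p (directions p g) ≠ 0 → explicitStep B (p, g) ∈ nonsingularPairs B}
  have hN : MeasurableSet N := by
    have h1 : MeasurableSet {g | IsRegular B (p, g)} :=
      measurable_prodMk_left measurableSet_isRegular
    have h2 : MeasurableSet {g | crossPairing B p (directions p g) = 0} :=
      (measurable_crossPairing_directions.comp measurable_prodMk_left) (measurableSet_singleton 0)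
    have h3 : MeasurableSet {g | explicitStep B (p, g) ∈ nonsingularPairs B} :=
      (measurable_explicitStep.comp measurable_prodMk_left) measurableSet_nonsingularPairs
    have : N = {g | IsRegular B (p, g)}ᶜ ∪ ({g | crossPairing B p (directions p g) = 0} ∪
        {g | explicitStep B (p, g) ∈ nonsingularPairs B}) := by
      ext g
      simp only [N, Set.mem_ofPred_eq, Set.mem_union, Set.mem_compl_iff]
      tauto
    rw [this]
    exact h1.compl.union (h2.union h3)
  have hNae : ∀ᵐ g ∂((stdGaussian (E m)).prod (stdGaussian (E d))), g ∈ N := by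
    have hbad : ∀ g ∉ N, (directions p g).1 ∈ badDirections B p.1 p.2 (directions p g).2 ∧
        (directions p g).2 ∈ badDirections (ContinuousLinearMap.adjoint B) p.2 p.1
          (directions p g).1 := by
      intro g hg
      simp only [N, Set.mem_ofPred_eq, Classical.not_imp] at hg
      obtain ⟨hreg, hc, hns⟩ := hg
      have : ¬ (pairing B (explicitStep B (p, g)) = ‖B‖ ∨ ¬ IsStationary B (explicitStep B (p, g))) :=
        fun h => hns ⟨explicitStep_mem_unitPairs (s := (p, g)) hU hreg, h⟩
      rw [not_or, not_not] at this
      exact mem_badDirections_of_isStationary (s := (p, g)) hreg hc hU this.1 this.2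
    -- The sample in the space of dimension at least 3 is drawn last: it must avoid finitely many
    -- directions fixed by the other one.
    rcases le_max_iff.1 h3 with h | h
    · refine ae_prod_of_ae_ae hN ?_
      filter_upwards [ae_finite_badDirections (B := B) hd p.1 hU.2.1] with y hy
      filter_upwards [ae_direction_notMem_finite h hU.1 hy] with z hz
      by_contra hzN
      exact hz (hbad _ hzN).1
    · refine (Measure.ae_prod_iff_ae_ae hN).2 ?_
      filter_upwards [ae_finite_badDirections (B := ContinuousLinearMap.adjoint B) hm p.2 hU.1]
        with z hz
      filter_upwards [ae_direction_notMem_finite h hU.2.1 hz] with y hy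
      by_contra hyN
      exact hy (hbad _ hyN).2
  filter_upwards [hnd, hcross, hNae] with g h1 h2 h3
  have hreg : IsRegular B (p, g) := ⟨h1, Or.inl h2⟩
  exact ⟨hreg, h3 hreg h2⟩

end NonsingularStates

/-! ### The case m = d = 2. -/

section Plane

variable (B : E 2 →L[ℝ] E 2)

/-- The matrix entries of `B`. -/
noncomputable def entry (i j : Fin 2) : ℝ := B (EuclideanSpace.single j 1) i

/-- The value on `p` of the part of `B` that commutes with rotations. -/
noncomputable def conformalPart (p : E 2 × E 2) : ℝ :=
  (entry B 0 0 + entry B 1 1) / 2 * (p.1 0 * p.2 0 + p.1 1 * p.2 1)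
    + (entry B 1 0 - entry B 0 1) / 2 * (p.1 1 * p.2 0 - p.1 0 * p.2 1)

/-- The derivative of `conformalPart` when `p.1` is rotated. -/
noncomputable def conformalPerp (p : E 2 × E 2) : ℝ :=
  (entry B 0 0 + entry B 1 1) / 2 * (p.1 0 * p.2 1 - p.1 1 * p.2 0)
    + (entry B 1 0 - entry B 0 1) / 2 * (p.1 0 * p.2 0 + p.1 1 * p.2 1)

/-- The value on `p` of the part of `B` that anticommutes with the quarter turn. -/
noncomputable def anticonformalPart (p : E 2 × E 2) : ℝ :=
  (entry B 0 0 - entry B 1 1) / 2 * (p.1 0 * p.2 0 - p.1 1 * p.2 1)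
    + (entry B 1 0 + entry B 0 1) / 2 * (p.1 1 * p.2 0 + p.1 0 * p.2 1)

/-- The derivative of `anticonformalPart` when `p.1` is rotated. -/
noncomputable def anticonformalPerp (p : E 2 × E 2) : ℝ :=
  (entry B 0 0 - entry B 1 1) / 2 * (-(p.1 1 * p.2 0) - p.1 0 * p.2 1)
    + (entry B 1 0 + entry B 0 1) / 2 * (p.1 0 * p.2 0 - p.1 1 * p.2 1)

/-- The maximum of `conformalPart` over pairs of unit vectors. -/
noncomputable def conformalRadius : ℝ :=
  √(((entry B 0 0 + entry B 1 1) / 2) ^ 2 + ((entry B 1 0 - entry B 0 1) / 2) ^ 2)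

/-- The maximum of `anticonformalPart` over pairs of unit vectors. -/
noncomputable def anticonformalRadius : ℝ :=
  √(((entry B 0 0 - entry B 1 1) / 2) ^ 2 + ((entry B 1 0 + entry B 0 1) / 2) ^ 2)

/-- Pairs of unit vectors with nonnegative objective at which neither part of `B` is minimal,
unless it vanishes. -/
def generalPositionPairs : Set (E 2 × E 2) :=
  {p | p ∈ unitPairs B ∧ (conformalRadius B ≠ 0 → conformalPart B p ≠ -conformalRadius B) ∧
    (anticonformalRadius B ≠ 0 → anticonformalPart B p ≠ -anticonformalRadius B)}

variable {B}

theorem apply_eq_entry (v : E 2) (i : Fin 2) : B v i = v 0 * entry B i 0 + v 1 * entry B i 1 := by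
  have : v = v 0 • EuclideanSpace.single 0 1 + v 1 • EuclideanSpace.single 1 1 := by
    ext j
    fin_cases j <;> simp
  conv_lhs => rw [this]
  simp [entry]

theorem pairing_eq_entries (p : E 2 × E 2) : pairing B p =
    p.1 0 * (p.2 0 * entry B 0 0 + p.2 1 * entry B 0 1)
      + p.1 1 * (p.2 0 * entry B 1 0 + p.2 1 * entry B 1 1) := by
  rw [pairing, PiLp.inner_apply, Fin.sum_univ_two, apply_eq_entry, apply_eq_entry]
  simp
  ring

theorem pairing_eq_parts (p : E 2 × E 2) :
    pairing B p = conformalPart B p + anticonformalPart B p := by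
  rw [pairing_eq_entries, conformalPart, anticonformalPart]
  ring

theorem norm_sq_eq_coords (u : E 2) : ‖u‖ ^ 2 = u 0 ^ 2 + u 1 ^ 2 := by
  simp [EuclideanSpace.norm_sq_eq]

theorem conformal_sq_add_sq {p : E 2 × E 2} (hu : ‖p.1‖ = 1) (hv : ‖p.2‖ = 1) :
    conformalPart B p ^ 2 + conformalPerp B p ^ 2 = conformalRadius B ^ 2 := by
  have h1 := norm_sq_eq_coords p.1
  have h2 := norm_sq_eq_coords p.2
  rw [hu] at h1
  rw [hv] at h2
  rw [conformalRadius, Real.sq_sqrt (by positivity)]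
  have : conformalPart B p ^ 2 + conformalPerp B p ^ 2
      = (((entry B 0 0 + entry B 1 1) / 2) ^ 2 + ((entry B 1 0 - entry B 0 1) / 2) ^ 2) *
        ((p.1 0 ^ 2 + p.1 1 ^ 2) * (p.2 0 ^ 2 + p.2 1 ^ 2)) := by
    rw [conformalPart, conformalPerp]
    ring
  rw [this, ← h1, ← h2]
  ring

theorem anticonformal_sq_add_sq {p : E 2 × E 2} (hu : ‖p.1‖ = 1) (hv : ‖p.2‖ = 1) :
    anticonformalPart B p ^ 2 + anticonformalPerp B p ^ 2 = anticonformalRadius B ^ 2 := by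
  have h1 := norm_sq_eq_coords p.1
  have h2 := norm_sq_eq_coords p.2
  rw [hu] at h1
  rw [hv] at h2
  rw [anticonformalRadius, Real.sq_sqrt (by positivity)]
  have : anticonformalPart B p ^ 2 + anticonformalPerp B p ^ 2
      = (((entry B 0 0 - entry B 1 1) / 2) ^ 2 + ((entry B 1 0 + entry B 0 1) / 2) ^ 2) *
        ((p.1 0 ^ 2 + p.1 1 ^ 2) * (p.2 0 ^ 2 + p.2 1 ^ 2)) := by
    rw [anticonformalPart, anticonformalPerp]
    ring
  rw [this, ← h1, ← h2]
  ring

theorem exists_sign_of_orthogonal {u w : E 2} (hu : ‖u‖ = 1) (hw : ‖w‖ = 1)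
    (h : (inner ℝ u w : ℝ) = 0) :
    ∃ ε : ℝ, (ε = 1 ∨ ε = -1) ∧ w 0 = -ε * u 1 ∧ w 1 = ε * u 0 := by
  have h1 := norm_sq_eq_coords u
  have h2 := norm_sq_eq_coords w
  rw [hu] at h1
  rw [hw] at h2
  rw [PiLp.inner_apply, Fin.sum_univ_two] at h
  simp only [RCLike.inner_apply, conj_trivial] at h
  -- The sign is the determinant of (u, w).
  refine ⟨w 1 * u 0 - w 0 * u 1, ?_, ?_, ?_⟩
  · rw [← mul_self_eq_one_iff]
    linear_combination (-(u 0 ^ 2 + u 1 ^ 2)) * h2 - h1 - (w 0 * u 0 + w 1 * u 1) * h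
  · linear_combination w 0 * h1 + u 0 * h
  · linear_combination w 1 * h1 + u 1 * h

theorem topEigenvalue_rotation {p q r ε : ℝ} (hε : ε = 1 ∨ ε = -1) :
    topEigenvalue (p + q) (2 * ε * r) (p - q) = p + √(q ^ 2 + r ^ 2) := by
  have hε2 : ε ^ 2 = 1 := by rcases hε with h | h <;> simp [h]
  have : ((p + q - (p - q)) / 2) ^ 2 + (2 * ε * r / 2) ^ 2 = q ^ 2 + r ^ 2 := by
    linear_combination r ^ 2 * hε2
  rw [topEigenvalue, this]
  ring

/-- Here p is the part that the step fixes and q the one that it moves, with derivative r. A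
maximizer is missing only for r = 0 and q < 0, that is, at the minimum q = -ρ; otherwise the step
lifts q to ρ. -/
theorem rotation_step {p q r ε ρ : ℝ} (hε : ε = 1 ∨ ε = -1) (hρ : 0 ≤ ρ)
    (hqr : q ^ 2 + r ^ 2 = ρ ^ 2) (hgen : ρ ≠ 0 → q ≠ -ρ) :
    (2 * ε * r ≠ 0 ∨ p - q ≤ p + q) ∧ topEigenvalue (p + q) (2 * ε * r) (p - q) = p + ρ := by
  constructor
  · by_contra! h
    have hε0 : ε ≠ 0 := by rcases hε with h | h <;> simp [h]
    have hr : r = 0 := by simpa [hε0] using h.1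
    have hq : q < 0 := by linarith [h.2]
    rw [hr] at hqr
    rcases sq_eq_sq_iff_eq_or_eq_neg.1 (by linarith : q ^ 2 = ρ ^ 2) with h1 | h1
    · linarith
    · exact hgen (by rintro rfl; simp at h1; exact hq.ne h1) h1
  · rw [topEigenvalue_rotation hε, hqr, Real.sqrt_sq hρ]

/-- Equal signs mean that u and v turn by the same angle, up to the factor √(1 + τ²), and the
conformal part commutes with rotations. With opposite signs the same holds for the anticonformal
part. -/
theorem conformalPart_rotation {p q : E 2 × E 2} {ε t τ : ℝ} (hw0 : q.1 0 = -ε * p.1 1)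
    (hw1 : q.1 1 = ε * p.1 0) (hx0 : q.2 0 = -ε * p.2 1) (hx1 : q.2 1 = ε * p.2 0) :
    conformalPart B (t • (p + τ • q)) = t ^ 2 * (1 + τ ^ 2 * ε ^ 2) * conformalPart B p := by
  simp only [conformalPart, Prod.smul_fst, Prod.fst_add, Prod.smul_snd, Prod.snd_add,
    PiLp.smul_apply, PiLp.add_apply, smul_eq_mul, hw0, hw1, hx0, hx1]
  ring

theorem anticonformalPart_rotation {p q : E 2 × E 2} {ε t τ : ℝ} (hw0 : q.1 0 = -ε * p.1 1)
    (hw1 : q.1 1 = ε * p.1 0) (hx0 : q.2 0 = - -ε * p.2 1) (hx1 : q.2 1 = -ε * p.2 0) :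
    anticonformalPart B (t • (p + τ • q)) =
      t ^ 2 * (1 + τ ^ 2 * ε ^ 2) * anticonformalPart B p := by
  simp only [anticonformalPart, Prod.smul_fst, Prod.fst_add, Prod.smul_snd, Prod.snd_add,
    PiLp.smul_apply, PiLp.add_apply, smul_eq_mul, hw0, hw1, hx0, hx1]
  ring

/-- If u and v turn in the same sense, the conformal part is unchanged and the anticonformal part
reaches its maximum; in opposite senses the roles are exchanged. A part at its maximum ρ is not at
-ρ unless ρ = 0, so general position persists for every nondegenerate sample. -/
theorem explicitStep_mem_generalPositionPairs {s : (E 2 × E 2) × (E 2 × E 2)}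
    (hs : s.1 ∈ generalPositionPairs B)
    (hg : s.2.1 - (inner ℝ s.2.1 s.1.1 : ℝ) • s.1.1 ≠ 0 ∧
      s.2.2 - (inner ℝ s.2.2 s.1.2 : ℝ) • s.1.2 ≠ 0) :
    IsRegular B s ∧ explicitStep B s ∈ generalPositionPairs B := by
  obtain ⟨hU, hc, ha⟩ := hs
  obtain ⟨h1, h2, h3, h4⟩ := directions_spec hU.1 hU.2.1 hg
  obtain ⟨ε, hε, hw0, hw1⟩ := exists_sign_of_orthogonal hU.1 h1 h3
  obtain ⟨δ, hδ, hx0, hx1⟩ := exists_sign_of_orthogonal hU.2.1 h2 h4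
  have hε2 : ε ^ 2 = 1 := by rcases hε with h | h <;> simp [h]
  have hcsq := conformal_sq_add_sq (B := B) hU.1 hU.2.1
  have hasq := anticonformal_sq_add_sq (B := B) hU.1 hU.2.1
  have hcr : 0 ≤ conformalRadius B := Real.sqrt_nonneg _
  have har : 0 ≤ anticonformalRadius B := Real.sqrt_nonneg _
  have hτ : ((√(1 + explicitStepSize B s ^ 2))⁻¹) ^ 2 * (1 + explicitStepSize B s ^ 2) = 1 := by
    rw [inv_pow, Real.sq_sqrt (by positivity), inv_mul_cancel₀ (by positivity)]
  set q := directions s.1 s.2 with hq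
  have hsum := pairing_eq_parts (B := B) s.1
  have hcrossEq : crossPairing B s.1 q =
      (ε - δ) * conformalPerp B s.1 + (ε + δ) * anticonformalPerp B s.1 := by
    have e1 : (inner ℝ q.1 (B s.1.2) : ℝ) = pairing B (q.1, s.1.2) := rfl
    have e2 : (inner ℝ s.1.1 (B q.2) : ℝ) = pairing B (s.1.1, q.2) := rfl
    rw [crossPairing, e1, e2, pairing_eq_entries, pairing_eq_entries]
    simp only [hw0, hw1, hx0, hx1, conformalPerp, anticonformalPerp]
    ring
  have hqq : pairing B q = ε * δ * (conformalPart B s.1 - anticonformalPart B s.1) := by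
    rw [pairing_eq_entries, hw0, hw1, hx0, hx1, conformalPart, anticonformalPart]
    ring
  by_cases hεδ : ε = δ
  · subst hεδ
    obtain ⟨r1, r2⟩ := rotation_step (p := conformalPart B s.1) hε har hasq ha
    have e1 : pairing B q = conformalPart B s.1 - anticonformalPart B s.1 := by
      rw [hqq, ← pow_two, hε2, one_mul]
    have e2 : crossPairing B s.1 q = 2 * ε * anticonformalPerp B s.1 := by
      rw [hcrossEq]
      ring
    have hreg : IsRegular B s := ⟨hg, by rwa [← hq, e1, e2, hsum]⟩
    have hinv : conformalPart B (explicitStep B s) = conformalPart B s.1 := by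
      rw [explicitStep, ← hq, conformalPart_rotation hw0 hw1 hx0 hx1, hε2, mul_one, hτ, one_mul]
    have hval := pairing_explicitStep hreg
    rw [nextValue, ← hq, e1, e2, hsum, r2, pairing_eq_parts, hinv] at hval
    refine ⟨hreg, explicitStep_mem_unitPairs hU hreg, fun h => by rw [hinv]; exact hc h,
      fun h h' => h ?_⟩
    linarith
  · have hδε : δ = -ε := by
      rcases hε with rfl | rfl <;> rcases hδ with rfl | rfl <;> simp_all
    subst hδε
    obtain ⟨r1, r2⟩ := rotation_step (p := anticonformalPart B s.1) hε hcr hcsq hc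
    have e1 : pairing B q = anticonformalPart B s.1 - conformalPart B s.1 := by
      rw [hqq]
      linear_combination (anticonformalPart B s.1 - conformalPart B s.1) * hε2
    have e2 : crossPairing B s.1 q = 2 * ε * conformalPerp B s.1 := by
      rw [hcrossEq]
      ring
    rw [add_comm] at hsum
    have hreg : IsRegular B s := ⟨hg, by rwa [← hq, e1, e2, hsum]⟩
    have hinv : anticonformalPart B (explicitStep B s) = anticonformalPart B s.1 := by
      rw [explicitStep, ← hq, anticonformalPart_rotation hw0 hw1 hx0 hx1, hε2, mul_one, hτ,
        one_mul]
    have hval := pairing_explicitStep hreg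
    rw [nextValue, ← hq, e1, e2, hsum, r2, pairing_eq_parts, hinv] at hval
    refine ⟨hreg, explicitStep_mem_unitPairs hU hreg, fun h h' => h ?_,
      fun h => by rw [hinv]; exact ha h⟩
    linarith

theorem measurableSet_generalPositionPairs : MeasurableSet (generalPositionPairs B) := by
  have h1 : Measurable (conformalPart B) := by
    unfold conformalPart; fun_prop
  have h2 : Measurable (anticonformalPart B) := by
    unfold anticonformalPart; fun_prop
  refine isCompact_unitPairs.isClosed.measurableSet.inter (MeasurableSet.inter ?_ ?_)
  · exact MeasurableSet.imp (.const _) (h1 (measurableSet_singleton _)).compl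
  · exact MeasurableSet.imp (.const _) (h2 (measurableSet_singleton _)).compl

end Plane

/-! ### Initial states. -/

section Start

theorem ae_uniformSphere_norm (n : ℕ) : ∀ᵐ x ∂uniformSphere n, ‖x‖ = 1 := by
  refine (ae_map_iff measurable_subtype_coe.aemeasurable
    (measurable_norm (measurableSet_singleton 1))).2 (Eventually.of_forall fun x => ?_)
  simp

open scoped Pointwise in
theorem ae_uniformSphere_notMem_submodule {n : ℕ} {W : Submodule ℝ (E n)} (hW : W ≠ ⊤) :
    ∀ᵐ x ∂uniformSphere n, x ∉ W := by
  have hWm : MeasurableSet (W : Set (E n)) := W.closed_of_finiteDimensional.measurableSet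
  refine (ae_map_iff measurable_subtype_coe.aemeasurable hWm.compl).2 ?_
  refine cond_absolutelyContinuous.ae_le ?_
  have h : (volume : Measure (E n)).toSphere (Subtype.val ⁻¹' (W : Set (E n))) = 0 := by
    -- The spherical measure is a multiple of the volume of the cone over the set, and that cone
    -- lies in the null set `W`.
    rw [Measure.toSphere_apply' _ (measurable_subtype_coe hWm)]
    have hsub : Set.Ioo (0 : ℝ) 1 • (Subtype.val '' (Subtype.val ⁻¹' (W : Set (E n)) :
        Set (Metric.sphere (0 : E n) 1))) ⊆ (W : Set (E n)) := by
      rintro _ ⟨t, -, _, ⟨x, hx, rfl⟩, rfl⟩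
      exact W.smul_mem t hx
    rw [measure_mono_null hsub (Measure.addHaar_submodule volume W hW), mul_zero]
  exact measure_eq_zero_iff_ae_notMem.1 h

theorem ae_uniformSphere_coords_ne {a b : ℝ} (h : a ^ 2 + b ^ 2 ≠ 0) :
    ∀ᵐ u ∂uniformSphere 2, u 0 * a + u 1 * b ≠ 0 := by
  have hin : ∀ u : E 2, (inner ℝ !₂[a, b] u : ℝ) = u 0 * a + u 1 * b := by
    intro u
    simp [PiLp.inner_apply, Fin.sum_univ_two]
  have hW : (Submodule.span ℝ {(!₂[a, b] : E 2)})ᗮ ≠ ⊤ := by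
    intro htop
    have h1 : (!₂[a, b] : E 2) ∈ (Submodule.span ℝ {(!₂[a, b] : E 2)})ᗮ := htop ▸ Submodule.mem_top
    rw [Submodule.mem_orthogonal_singleton_iff_inner_right, hin] at h1
    apply h
    simp at h1
    linarith
  filter_upwards [ae_uniformSphere_notMem_submodule hW] with u hu h0
  exact hu (Submodule.mem_orthogonal_singleton_iff_inner_right.2 (by rw [hin, h0]))

variable {d m : ℕ} {Ω : Type*} [MeasurableSpace Ω] {P : Measure Ω}
  {A V : E d →L[ℝ] E m} {u₀ : Ω → E m} {v₀ : Ω → E d}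

theorem objective_eq_pairing (u : E m) (v : E d) :
    objective A V u v = pairing (A - V) (u, v) := objective_eq A V u v

theorem pairing_neg_left {B : E d →L[ℝ] E m} (u : E m) (v : E d) :
    pairing B (-u, v) = -pairing B (u, v) := by
  simp [pairing]

theorem ae_of_hasLaw {S : Type*} [MeasurableSpace S] {μ : Measure S} {X : Ω → S}
    (hX : HasLaw X μ P) {p : S → Prop} (h : ∀ᵐ x ∂μ, p x) : ∀ᵐ ω ∂P, p (X ω) := by
  rw [← hX.map_eq] at h
  exact ae_of_ae_map hX.aemeasurable h

theorem sign_flip_spec {u u' : E m} {v : E d} (h : (0 < objective A V u v → u' = u) ∧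
    (objective A V u v ≤ 0 → u' = -u)) :
    (u' = u ∨ u' = -u) ∧ 0 ≤ pairing (A - V) (u', v) := by
  rw [objective_eq_pairing] at h
  rcases lt_or_ge 0 (pairing (A - V) (u, v)) with h1 | h1
  · rw [h.1 h1]
    exact ⟨Or.inl rfl, h1.le⟩
  · rw [h.2 h1, pairing_neg_left]
    exact ⟨Or.inr rfl, by linarith⟩

theorem IsUniformStart.aemeasurable (h : IsUniformStart A V P u₀ v₀) :
    AEMeasurable (fun ω => (u₀ ω, v₀ ω)) P := by
  classical
  obtain ⟨u, hu, hv, -, hsign⟩ := h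
  refine AEMeasurable.prodMk ?_ hv.aemeasurable
  have hs : MeasurableSet {p : E m × E d | 0 < pairing (A - V) p} :=
    measurableSet_lt measurable_const measurable_pairing
  have hf : Measurable fun p : E m × E d => if 0 < pairing (A - V) p then p.1 else -p.1 :=
    Measurable.ite hs measurable_fst measurable_fst.neg
  refine (hf.comp_aemeasurable (hu.aemeasurable.prodMk hv.aemeasurable)).congr
    (Eventually.of_forall fun ω => ?_)
  have h1 := hsign ω
  rw [objective_eq_pairing] at h1
  simp only [Function.comp_apply]
  split_ifs with h
  · exact (h1.1 h).symm
  · exact (h1.2 (not_lt.1 h)).symm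

theorem IsUniformStart.ae_mem_unitPairs (h : IsUniformStart A V P u₀ v₀) :
    ∀ᵐ ω ∂P, (u₀ ω, v₀ ω) ∈ unitPairs (A - V) := by
  obtain ⟨u, hu, hv, -, hsign⟩ := h
  filter_upwards [ae_of_hasLaw hu (ae_uniformSphere_norm m),
    ae_of_hasLaw hv (ae_uniformSphere_norm d)] with ω h1 h2
  obtain ⟨h3, h4⟩ := sign_flip_spec (hsign ω)
  refine ⟨?_, h2, h4⟩
  rcases h3 with h3 | h3 <;> simp [h3, h1]

/-- Already v⁰ almost surely avoids the finitely many singular spaces below the top, whatever u⁰ is.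
-/
theorem IsUniformStart.ae_mem_nonsingularPairs (hd : 2 ≤ d) (h : IsUniformStart A V P u₀ v₀) :
    ∀ᵐ ω ∂P, (u₀ ω, v₀ ω) ∈ nonsingularPairs (A - V) := by
  have hU := h.ae_mem_unitPairs
  obtain ⟨u, hu, hv, -, -⟩ := h
  have h : ∀ᵐ y ∂uniformSphere d, ∀ μ ∈ {μ : ℝ | 0 ≤ μ ∧ singularSpace (A - V) μ ≠ ⊥},
      μ < ‖A - V‖ → y ∉ singularSpace (A - V) μ := by
    rw [ae_ball_iff (finite_singularValues _).countable]
    intro μ hμ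
    by_cases hB : μ < ‖A - V‖
    · filter_upwards [ae_uniformSphere_notMem_submodule
        (singularSpace_ne_top (by omega) hμ.1 hB)] with y hy _ using hy
    · exact Eventually.of_forall fun y h => absurd h hB
  filter_upwards [hU, ae_of_hasLaw hv h] with ω h1 h2
  refine ⟨h1, or_iff_not_imp_left.2 fun hne hst => ?_⟩
  have hmem := mem_singularSpace_of_pair hst.1 hst.2
  have hv0 : v₀ ω ≠ 0 := by
    rw [← norm_ne_zero_iff, h1.2.1]
    exact one_ne_zero
  exact h2 _ ⟨h1.2.2, (Submodule.ne_bot_iff _).2 ⟨_, hmem, hv0⟩⟩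
    (lt_of_le_of_ne (pairing_le_norm h1.1 h1.2.1) hne) hmem

theorem IsNonsingularStart.ae_mem_nonsingularPairs (h : IsNonsingularStart A V P u₀ v₀) :
    ∀ᵐ ω ∂P, (u₀ ω, v₀ ω) ∈ nonsingularPairs (A - V) := by
  filter_upwards [h.norm_u, h.norm_v, h.objective_nonneg, h.not_singular] with ω h1 h2 h3 h4
  rw [objective_eq_pairing] at h3
  exact ⟨⟨h1, h2, h3⟩, Or.inr fun hst => h4 ⟨_, h3, h1, h2, hst.1, hst.2⟩⟩

end Start

/-! ### Uniform initialization in the plane. -/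

section PlaneStart

variable {Ω : Type*} [MeasurableSpace Ω] {P : Measure Ω} [IsProbabilityMeasure P]
  {A V : E 2 →L[ℝ] E 2} {u₀ v₀ : Ω → E 2}

/-- For fixed v this is a linear form in u whose coefficient vector has squared norm ρ²‖v‖², with ρ
the conformal radius. A nonzero derivative excludes the extremal values ±ρ. -/
theorem ae_conformalPerp_ne_zero (B : E 2 →L[ℝ] E 2) {v : E 2} (hv : ‖v‖ = 1) :
    ∀ᵐ u ∂uniformSphere 2, conformalRadius B ≠ 0 → conformalPerp B (u, v) ≠ 0 := by
  by_cases h : conformalRadius B = 0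
  · exact Eventually.of_forall fun u h' => absurd h h'
  have h1 := norm_sq_eq_coords v
  rw [hv] at h1
  have h2 : conformalRadius B ^ 2 = _ := Real.sq_sqrt (by positivity)
  have h3 : ((entry B 0 0 + entry B 1 1) / 2 * v 1 + (entry B 1 0 - entry B 0 1) / 2 * v 0) ^ 2
      + ((entry B 1 0 - entry B 0 1) / 2 * v 1 - (entry B 0 0 + entry B 1 1) / 2 * v 0) ^ 2 ≠ 0 := by
    have h4 : conformalRadius B ^ 2 ≠ 0 := pow_ne_zero 2 h
    intro h5
    apply h4
    rw [h2]
    linear_combination h5 + (((entry B 0 0 + entry B 1 1) / 2) ^ 2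
      + ((entry B 1 0 - entry B 0 1) / 2) ^ 2) * h1
  filter_upwards [ae_uniformSphere_coords_ne h3] with u hu _ h0
  apply hu
  rw [← h0, conformalPerp]
  ring

theorem ae_anticonformalPerp_ne_zero (B : E 2 →L[ℝ] E 2) {v : E 2} (hv : ‖v‖ = 1) :
    ∀ᵐ u ∂uniformSphere 2, anticonformalRadius B ≠ 0 → anticonformalPerp B (u, v) ≠ 0 := by
  by_cases h : anticonformalRadius B = 0
  · exact Eventually.of_forall fun u h' => absurd h h'
  have h1 := norm_sq_eq_coords v
  rw [hv] at h1
  have h2 : anticonformalRadius B ^ 2 = _ := Real.sq_sqrt (by positivity)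
  have h3 : ((entry B 1 0 + entry B 0 1) / 2 * v 0 - (entry B 0 0 - entry B 1 1) / 2 * v 1) ^ 2
      + (-((entry B 0 0 - entry B 1 1) / 2 * v 0) - (entry B 1 0 + entry B 0 1) / 2 * v 1) ^ 2
        ≠ 0 := by
    have h4 : anticonformalRadius B ^ 2 ≠ 0 := pow_ne_zero 2 h
    intro h5
    apply h4
    rw [h2]
    linear_combination h5 + (((entry B 0 0 - entry B 1 1) / 2) ^ 2
      + ((entry B 1 0 + entry B 0 1) / 2) ^ 2) * h1
  filter_upwards [ae_uniformSphere_coords_ne h3] with u hu _ h0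
  apply hu
  rw [← h0, anticonformalPerp]
  ring

theorem IsUniformStart.ae_mem_generalPositionPairs (h : IsUniformStart A V P u₀ v₀) :
    ∀ᵐ ω ∂P, (u₀ ω, v₀ ω) ∈ generalPositionPairs (A - V) := by
  have hU := h.ae_mem_unitPairs
  obtain ⟨u, hu, hv, hind, hsign⟩ := h
  set B := A - V
  have hperp1 : Measurable (conformalPerp B) := by
    unfold conformalPerp; fun_prop
  have hperp2 : Measurable (anticonformalPerp B) := by
    unfold anticonformalPerp; fun_prop
  have hprob : IsProbabilityMeasure (uniformSphere 2) := by
    rw [← hv.map_eq]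
    exact Measure.isProbabilityMeasure_map hv.aemeasurable
  have hlaw : HasLaw (fun ω => (u ω, v₀ ω)) ((uniformSphere 2).prod (uniformSphere 2)) P := by
    refine ⟨hu.aemeasurable.prodMk hv.aemeasurable, ?_⟩
    rw [(indepFun_iff_map_prod_eq_prod_map_map hu.aemeasurable hv.aemeasurable).1 hind, hu.map_eq,
      hv.map_eq]
  have hne : ∀ᵐ p ∂((uniformSphere 2).prod (uniformSphere 2)),
      p ∈ {p | (conformalRadius B ≠ 0 → conformalPerp B p ≠ 0) ∧
        (anticonformalRadius B ≠ 0 → anticonformalPerp B p ≠ 0)} := by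
    refine ae_prod_of_ae_ae (MeasurableSet.inter ?_ ?_) ?_
    · exact MeasurableSet.imp (.const _) (hperp1 (measurableSet_singleton 0)).compl
    · exact MeasurableSet.imp (.const _) (hperp2 (measurableSet_singleton 0)).compl
    · filter_upwards [ae_uniformSphere_norm 2] with v hv
      exact (ae_conformalPerp_ne_zero B hv).and (ae_anticonformalPerp_ne_zero B hv)
  filter_upwards [hU, ae_of_hasLaw hlaw hne] with ω h1 h2
  have h3 := conformal_sq_add_sq (B := B) h1.1 h1.2.1
  have h4 := anticonformal_sq_add_sq (B := B) h1.1 h1.2.1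
  -- The sign flip of u only changes the signs of the derivatives, so independence of the unflipped
  -- u and v⁰ suffices.
  have h5 : conformalPerp B (u₀ ω, v₀ ω) ^ 2 = conformalPerp B (u ω, v₀ ω) ^ 2 ∧
      anticonformalPerp B (u₀ ω, v₀ ω) ^ 2 = anticonformalPerp B (u ω, v₀ ω) ^ 2 := by
    rcases (sign_flip_spec (hsign ω)).1 with h | h
    · rw [h]
      exact ⟨rfl, rfl⟩
    · rw [h]
      simp only [conformalPerp, anticonformalPerp, PiLp.neg_apply]
      constructor <;> ring
  refine ⟨h1, fun hr h => h2.1 hr ?_, fun hr h => h2.2 hr ?_⟩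
  · rw [← pow_eq_zero_iff two_ne_zero, ← h5.1]
    rw [h] at h3
    linarith
  · rw [← pow_eq_zero_iff two_ne_zero, ← h5.2]
    rw [h] at h4
    linarith

end PlaneStart

/-! ### Convergence of the pairs. -/

section Limit

variable {d m : ℕ} {B : E d →L[ℝ] E m}

theorem isSingularPair_of_norm_eq (hB : 0 < ‖B‖) {v : E d} (hv : ‖v‖ = 1) (h : ‖B v‖ = ‖B‖) :
    IsSingularPair B ‖B‖ (‖B‖⁻¹ • B v) v := by
  refine ⟨hB.le, ?_, hv, ?_, ?_⟩
  · rw [norm_smul, norm_inv, norm_norm, h, inv_mul_cancel₀ hB.ne']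
  · rw [smul_smul, mul_inv_cancel₀ hB.ne', one_smul]
  · rw [map_smul, adjoint_apply_of_norm_eq hv h, smul_smul]
    congr 1
    field_simp

theorem mem_topSingularSpace_of_norm_eq {v : E d} (hv : ‖v‖ = 1) (h : ‖B v‖ = ‖B‖) :
    v ∈ topSingularSpace B := by
  simpa [topSingularSpace] using adjoint_apply_of_norm_eq hv h

theorem norm_apply_eq_of_pairing_eq {p : E m × E d} (hu : ‖p.1‖ = 1) (hv : ‖p.2‖ = 1)
    (h : pairing B p = ‖B‖) : ‖B p.2‖ = ‖B‖ := by
  refine le_antisymm (by simpa [hv] using B.le_opNorm p.2) ?_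
  have := real_inner_le_norm p.1 (B p.2)
  rw [hu, one_mul] at this
  rw [← h]
  exact this

theorem opNorm_pos_of_finrank_topSingularSpace (hd : 2 ≤ d)
    (h : Module.finrank ℝ (topSingularSpace B) = 1) : 0 < ‖B‖ := by
  rw [norm_pos_iff]
  rintro rfl
  have : topSingularSpace (0 : E d →L[ℝ] E m) = ⊤ := by
    rw [Submodule.eq_top_iff']
    intro v
    simp [topSingularSpace]
  rw [this, finrank_top, finrank_euclideanSpace_fin] at h
  omega

theorem inner_sq_eq_one_of_pairing_eq (h1 : Module.finrank ℝ (topSingularSpace B) = 1) {e : E d}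
    (he : ‖e‖ = 1) (hBe : ‖B e‖ = ‖B‖) {p : E m × E d} (hu : ‖p.1‖ = 1) (hv : ‖p.2‖ = 1)
    (h : pairing B p = ‖B‖) : (inner ℝ e p.2 : ℝ) ^ 2 = 1 := by
  have hmem := mem_topSingularSpace_of_norm_eq hv (norm_apply_eq_of_pairing_eq hu hv h)
  have he0 : (⟨e, mem_topSingularSpace_of_norm_eq he hBe⟩ : topSingularSpace B) ≠ 0 := by
    intro h0
    have : e = 0 := congrArg Subtype.val h0
    rw [this, norm_zero] at he
    exact zero_ne_one he
  obtain ⟨c, hc⟩ := (finrank_eq_one_iff_of_nonzero' _ he0).1 h1 ⟨p.2, hmem⟩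
  have hc' : c • e = p.2 := congrArg Subtype.val hc
  have h2 : |c| = 1 := by rwa [← hc', norm_smul, he, mul_one] at hv
  rw [← hc', inner_smul_right, real_inner_self_eq_norm_sq, he, ← sq_abs]
  simp [h2]

theorem tendsto_inner_sq (h1 : Module.finrank ℝ (topSingularSpace B) = 1) {e : E d}
    (he : ‖e‖ = 1) (hBe : ‖B e‖ = ‖B‖) {p : ℕ → E m × E d} (hp : ∀ k, p k ∈ unitPairs B)
    (hlim : Tendsto (fun k => pairing B (p k)) atTop (𝓝 ‖B‖)) :
    Tendsto (fun k => (inner ℝ e (p k).2 : ℝ) ^ 2) atTop (𝓝 1) := by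
  have hφ : Continuous fun p : E m × E d => ENNReal.ofReal (‖B‖ - pairing B p) :=
    ENNReal.continuous_ofReal.comp (continuous_const.sub continuous_pairing)
  refine tendsto_of_isCompact_of_forall_seq (φ := fun p => ENNReal.ofReal (‖B‖ - pairing B p))
    (ψ := fun p : E m × E d => (inner ℝ e p.2 : ℝ) ^ 2) isCompact_unitPairs (by fun_prop)
    (fun s hs y hy h0 => ?_) hp ?_
  · have h2 := tendsto_nhds_unique ((hφ.tendsto s).comp hy) h0
    have h3 := pairing_le_norm (B := B) hs.1 hs.2.1
    rw [ENNReal.ofReal_eq_zero] at h2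
    exact inner_sq_eq_one_of_pairing_eq h1 he hBe hs.1 hs.2.1 (by linarith)
  · have := ENNReal.tendsto_ofReal ((tendsto_const_nhds (x := ‖B‖)).sub hlim)
    simpa using this

/-- The components of v and w orthogonal to e have norm at most 1/2, so ⟨v, w⟩ differs from the
product of the e-coordinates by at most 1/4. That product exceeds 3/4 in absolute value, so a
negative sign would contradict ⟨v, w⟩ ≥ 0. -/
theorem mul_inner_pos_of_near {n : ℕ} {e v w : E n} (he : ‖e‖ = 1) (hv : ‖v‖ = 1) (hw : ‖w‖ = 1)
    (hvw : 0 ≤ (inner ℝ v w : ℝ)) (h1 : 3 / 4 < (inner ℝ e v : ℝ) ^ 2)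
    (h2 : 3 / 4 < (inner ℝ e w : ℝ) ^ 2) : 0 < (inner ℝ e v : ℝ) * inner ℝ e w := by
  set a : ℝ := inner ℝ e v with ha
  set b : ℝ := inner ℝ e w with hb
  have hdist : ∀ x : E n, ‖x‖ = 1 → ‖x - (inner ℝ e x : ℝ) • e‖ ^ 2 = 1 - (inner ℝ e x : ℝ) ^ 2 := by
    intro x hx
    rw [norm_sub_sq_real, norm_smul, inner_smul_right, he, hx, real_inner_comm, mul_one,
      Real.norm_eq_abs, sq_abs]
    ring
  have hprod : (inner ℝ (v - a • e) (w - b • e) : ℝ) = inner ℝ v w - a * b := by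
    rw [inner_sub_left, inner_sub_right, inner_sub_right, inner_smul_left, inner_smul_right,
      inner_smul_right, inner_smul_left, real_inner_self_eq_norm_sq, he, real_inner_comm e v,
      ← ha, ← hb]
    simp
  have hcs := real_inner_le_norm (v - a • e) (w - b • e)
  rw [hprod] at hcs
  have hn1 : ‖v - a • e‖ ≤ 1 / 2 := by
    refine (sq_le_sq₀ (norm_nonneg _) (by norm_num)).1 ?_
    rw [hdist v hv]
    linarith
  have hn2 : ‖w - b • e‖ ≤ 1 / 2 := by
    refine (sq_le_sq₀ (norm_nonneg _) (by norm_num)).1 ?_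
    rw [hdist w hw]
    linarith
  have hn := mul_le_mul hn1 hn2 (norm_nonneg _) (by norm_num)
  by_contra! hneg
  have hlow : -(1 / 4) ≤ a * b := by linarith
  have hsq : (a * b) ^ 2 ≤ (1 / 4) ^ 2 := sq_le_sq' hlow (by linarith)
  have : 3 / 4 * (3 / 4) < a ^ 2 * b ^ 2 := mul_lt_mul'' h1 h2 (by norm_num) (by norm_num)
  rw [mul_pow] at hsq
  linarith

theorem tendsto_of_inner_tendsto_one {n : ℕ} {e : E n} {x : ℕ → E n} (he : ‖e‖ = 1)
    (hx : ∀ k, ‖x k‖ = 1) (h : Tendsto (fun k => (inner ℝ e (x k) : ℝ)) atTop (𝓝 1)) :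
    Tendsto x atTop (𝓝 e) := by
  rw [tendsto_iff_norm_sub_tendsto_zero]
  have h2 : Tendsto (fun k => √(2 - 2 * (inner ℝ e (x k) : ℝ))) atTop (𝓝 0) := by
    have := (Real.continuous_sqrt.tendsto _).comp ((tendsto_const_nhds (x := (2 : ℝ))).sub
      (h.const_mul 2))
    simpa [Function.comp_def] using this
  refine h2.congr fun k => ?_
  have : 2 - 2 * (inner ℝ e (x k) : ℝ) = ‖x k - e‖ ^ 2 := by
    rw [norm_sub_sq_real, hx, he, real_inner_comm]
    ring
  rw [this, Real.sqrt_sq (norm_nonneg _)]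

theorem exists_tendsto_singularPair (hd : 2 ≤ d)
    (h1 : Module.finrank ℝ (topSingularSpace B) = 1) {p : ℕ → E m × E d}
    (hp : ∀ k, p k ∈ unitPairs B) (hlim : Tendsto (fun k => pairing B (p k)) atTop (𝓝 ‖B‖))
    (hstep : ∀ k, 0 ≤ (inner ℝ (p k).2 (p (k + 1)).2 : ℝ)) :
    ∃ (u : E m) (v : E d), IsSingularPair B ‖B‖ u v ∧ Tendsto p atTop (𝓝 (u, v)) := by
  have hB := opNorm_pos_of_finrank_topSingularSpace hd h1
  obtain ⟨e₀, he₀, hBe₀⟩ := exists_norm_eq_opNorm (by omega) B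
  obtain ⟨N, hN⟩ := eventually_atTop.1
    ((tendsto_inner_sq h1 he₀ hBe₀ hp hlim).eventually (lt_mem_nhds (by norm_num : (3 / 4 : ℝ) < 1)))
  obtain ⟨e, he, hBe, heN, hN⟩ : ∃ e : E d, ‖e‖ = 1 ∧ ‖B e‖ = ‖B‖ ∧
      0 ≤ (inner ℝ e (p N).2 : ℝ) ∧ ∀ k ≥ N, 3 / 4 < (inner ℝ e (p k).2 : ℝ) ^ 2 := by
    rcases le_total 0 (inner ℝ e₀ (p N).2 : ℝ) with h | h
    · exact ⟨e₀, he₀, hBe₀, h, hN⟩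
    · exact ⟨-e₀, by simpa, by simpa, by simpa, by simpa⟩
  have hpos : ∀ k ≥ N, 0 < (inner ℝ e (p k).2 : ℝ) := by
    intro k hk
    induction k, hk using Nat.le_induction with
    | base =>
      refine lt_of_le_of_ne heN fun h => ?_
      have := hN N le_rfl
      rw [← h] at this
      norm_num at this
    | succ k hk ih =>
      exact (mul_pos_iff_of_pos_left ih).1 (mul_inner_pos_of_near he (hp k).2.1 (hp (k + 1)).2.1
        (hstep k) (hN k hk) (hN (k + 1) (by omega)))
  have hinner : Tendsto (fun k => (inner ℝ e (p k).2 : ℝ)) atTop (𝓝 1) := by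
    have h := (Real.continuous_sqrt.tendsto 1).comp (tendsto_inner_sq h1 he hBe hp hlim)
    rw [Real.sqrt_one] at h
    refine h.congr' ?_
    filter_upwards [eventually_ge_atTop N] with k hk
    exact Real.sqrt_sq (hpos k hk).le
  have hv := tendsto_of_inner_tendsto_one he (fun k => (hp k).2.1) hinner
  have hpair := isSingularPair_of_norm_eq hB he hBe
  refine ⟨‖B‖⁻¹ • B e, e, hpair, ?_⟩
  -- ‖B‖⟨Be/‖B‖, u^k⟩ = ⟨u^k, Bv^k⟩ + ⟨u^k, B(e - v^k)⟩, where the last term vanishes in the limit.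
  have hu : Tendsto (fun k => (inner ℝ (‖B‖⁻¹ • B e) (p k).1 : ℝ)) atTop (𝓝 1) := by
    have hdiff : Tendsto (fun k => (inner ℝ (p k).1 (B (e - (p k).2)) : ℝ)) atTop (𝓝 0) := by
      have h0 : Tendsto (fun k => ‖B (e - (p k).2)‖) atTop (𝓝 0) := by
        have := ((B.continuous.tendsto _).comp ((tendsto_const_nhds (x := e)).sub hv)).norm
        simpa using this
      refine squeeze_zero_norm (fun k => ?_) h0
      have := norm_inner_le_norm (𝕜 := ℝ) (p k).1 (B (e - (p k).2))
      rwa [(hp k).1, one_mul] at this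
    have h := (hlim.add hdiff).const_mul ‖B‖⁻¹
    rw [add_zero, inv_mul_cancel₀ hB.ne'] at h
    refine h.congr fun k => ?_
    rw [pairing, ← inner_add_right, ← map_add, add_sub_cancel, inner_smul_left, real_inner_comm]
    rfl
  exact (tendsto_of_inner_tendsto_one hpair.2.1 (fun k => (hp k).1) hu).prodMk_nhds hv

end Limit

/-! ### From the closed form back to the algorithm. -/

section Iterates

variable {d m : ℕ}

/-- The iterates with the closed form of the step size. -/
noncomputable def explicitIterate (B : E d →L[ℝ] E m) (p : E m × E d) (g : ℕ → E m × E d) :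
    ℕ → E m × E d
  | 0 => p
  | k + 1 => explicitStep B (explicitIterate B p g k, g k)

theorem iterate_eq_explicitIterate {A V : E d →L[ℝ] E m} {p : E m × E d} {g : ℕ → E m × E d}
    (h : ∀ k, explicitIterate (A - V) p g k ∈ unitPairs (A - V) ∧
      IsRegular (A - V) (explicitIterate (A - V) p g k, g k)) (k : ℕ) :
    iterate A V p g k = explicitIterate (A - V) p g k := by
  induction k with
  | zero => rfl
  | succ k ih =>
    rw [iterate, explicitIterate, ih]
    exact (step_eq_explicitStep (h k).1.1 (h k).1.2.1 (h k).2).1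

variable {Ω : Type*} [MeasurableSpace Ω] {P : Measure Ω} [IsProbabilityMeasure P]
  {A V : E d →L[ℝ] E m} {u₀ : Ω → E m} {v₀ : Ω → E d}

theorem exists_invariant_set (hd : 2 ≤ d) (hm : 2 ≤ m)
    (hstart : IsUniformStart A V P u₀ v₀ ∨ (3 ≤ max m d ∧ IsNonsingularStart A V P u₀ v₀)) :
    ∃ I : Set (E m × E d), MeasurableSet I ∧ I ⊆ unitPairs (A - V) ∧
      (∀ p ∈ I, ∀ᵐ g ∂((stdGaussian (E m)).prod (stdGaussian (E d))),
        IsRegular (A - V) (p, g) ∧ explicitStep (A - V) (p, g) ∈ I) ∧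
      ∀ᵐ ω ∂P, (u₀ ω, v₀ ω) ∈ I := by
  by_cases h3 : 3 ≤ max m d
  · refine ⟨nonsingularPairs (A - V), measurableSet_nonsingularPairs, fun p hp => hp.1,
      fun p hp => ae_explicitStep_mem_nonsingularPairs hd hm h3 hp, ?_⟩
    rcases hstart with h | h
    · exact h.ae_mem_nonsingularPairs hd
    · exact h.2.ae_mem_nonsingularPairs
  · have h := hstart.resolve_right fun h => h3 h.1
    obtain rfl : m = 2 := by omega
    obtain rfl : d = 2 := by omega
    refine ⟨generalPositionPairs (A - V), measurableSet_generalPositionPairs, fun p hp => hp.1,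
      fun p hp => ?_, h.ae_mem_generalPositionPairs⟩
    filter_upwards [ae_directions_nondegenerate hd hm p] with g hg
    exact explicitStep_mem_generalPositionPairs (s := (p, g)) hp hg

end Iterates

end JointStep

theorem mainTheorem2 {d m : ℕ} (hd : 2 ≤ d) (hm : 2 ≤ m)
    (A V : JointStep.E d →L[ℝ] JointStep.E m)
    {Ω : Type*} [MeasurableSpace Ω] (P : MeasureTheory.Measure Ω)
    [MeasureTheory.IsProbabilityMeasure P]
    (u₀ : Ω → JointStep.E m) (v₀ : Ω → JointStep.E d)
    (z : ℕ → Ω → JointStep.E m) (y : ℕ → Ω → JointStep.E d)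
    (hsamples : JointStep.IsGaussianSampling P z y)
    (hindep : ProbabilityTheory.IndepFun (fun ω => (u₀ ω, v₀ ω))
      (fun ω (k : ℕ) => (z k ω, y k ω)) P)
    (hstart : JointStep.IsUniformStart A V P u₀ v₀ ∨
      (3 ≤ max m d ∧ JointStep.IsNonsingularStart A V P u₀ v₀))
    (u : ℕ → Ω → JointStep.E m) (v : ℕ → Ω → JointStep.E d)
    (hiter : ∀ k ω, (u k ω, v k ω) =
      JointStep.iterate A V (u₀ ω, v₀ ω) (fun j => (z j ω, y j ω)) k) :
    (∀ᵐ ω ∂P, ∀ k, JointStep.IsOptimalAt A V (u₀ ω, v₀ ω) (fun j => (z j ω, y j ω)) k) ∧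
    (∀ᵐ ω ∂P, Filter.Tendsto (fun k => (inner ℝ (u k ω) ((A - V) (v k ω)) : ℝ))
      Filter.atTop (nhds ‖A - V‖)) ∧
    (Module.finrank ℝ (JointStep.topSingularSpace (A - V)) = 1 →
      ∀ᵐ ω ∂P, ∃ (uLim : JointStep.E m) (vLim : JointStep.E d),
        JointStep.IsSingularPair (A - V) ‖A - V‖ uLim vLim ∧
        Filter.Tendsto (fun k => (u k ω, v k ω)) Filter.atTop (nhds (uLim, vLim))) := by
  open JointStep in
  obtain ⟨I, hIm, hIU, hinv, hI0⟩ := exists_invariant_set hd hm hstart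
  have hX0 : AEMeasurable (fun ω => (u₀ ω, v₀ ω)) P := by
    rcases hstart with h | h
    · exact h.aemeasurable
    · exact h.2.aemeasurable_u.prodMk h.2.aemeasurable_v
  let X : ℕ → Ω → E m × E d := fun k ω => explicitIterate (A - V) (u₀ ω, v₀ ω)
    (fun j => (z j ω, y j ω)) k
  obtain ⟨hreg, hlim⟩ := ae_regular_and_tendsto (B := A - V) (X := X) hd hm hIm hIU hinv
    (fun _ _ => rfl) hX0
    (fun k => (hsamples.indep_pair k).hasLaw_prod (hsamples.law_z k) (hsamples.law_y k))
    hsamples.indep_steps hindep hI0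
  have hXeq : ∀ᵐ ω ∂P, ∀ k,
      iterate A V (u₀ ω, v₀ ω) (fun j => (z j ω, y j ω)) k = X k ω := by
    filter_upwards [hreg] with ω hω
    exact iterate_eq_explicitIterate fun k => ⟨hIU (hω k).1, (hω k).2⟩
  refine ⟨?_, ?_, fun hfin => ?_⟩
  · filter_upwards [hreg, hXeq] with ω h1 h2 k
    have h3 := hIU (h1 k).1
    unfold IsOptimalAt
    rw [h2 k]
    exact (step_eq_explicitStep h3.1 h3.2.1 (h1 k).2).2
  · filter_upwards [hXeq, hlim] with ω h2 h3
    refine h3.congr fun k => ?_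
    rw [← h2 k, ← hiter k ω]
    rfl
  · filter_upwards [hreg, hXeq, hlim] with ω h1 h2 h3
    obtain ⟨uLim, vLim, h4, h5⟩ := exists_tendsto_singularPair hd hfin (p := fun k => X k ω)
      (fun k => hIU (h1 k).1) h3 fun k => inner_explicitStep_snd_nonneg (hIU (h1 k).1).2.1
    refine ⟨uLim, vLim, h4, h5.congr fun k => ?_⟩
    rw [← h2 k, ← hiter k ω]
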